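/- Let $d\ge 1$, $\mathcal X=\{x\in\mathbb R^d:\|x\|_2\le 1,\ x_1=\tfrac12\}$, and let $\mathcal F_1^{\mathrm{lin}}$ be the class of functions $f:\mathcal X\to\mathbb R$ of the form $f(x)=\langle\theta,x\rangle$, $\theta\in\mathbb R^d$, with $|f(x)|\le 1$ for all $x\in\mathcal X$. Online protocol. An oblivious adversary fixes a sequence $(x_1,y_1),\dots,(x_T,y_T)$ in $\mathcal X\times\{0,1\}$ (it may know the forecaster's algorithm). In each round $t=1,\dots,T$ the forecaster sees $x_t$, chooses a distribution $\mathcal P_t$ on $\mathcal Z=\{0,\tfrac1N,\tfrac2N,\dots,1\}$ as a function of $x_1,\dots,x_t$ and $y_1,\dots,y_{t-1}$ (and of $d$ and $T$), draws the prediction $p_t\sim\mathcal P_t$ independently of the earlier predictions, and then observes $y_t$. Here the integer $N\ge1$ is chosen by the algorithm as a function of $d$ and $T$. The $\ell_1$-swap multicalibration error is $$\mathsf{SMCal}_{\mathcal F,1}=\sup_{\{f_p\in\mathcal F\}_{p\in\mathcal Z}}\ \sum_{p\in\mathcal Z}n_p\,|\rho_{p,f_p}|,\qquad n_p=\sum_{t=1}^T\mathbb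 I[p_t=p],\qquad \rho_{p,f}=\frac1{n_p}\sum_{t=1}^T\mathbb I[p_t=p]\,f(x_t)\,(y_t-p),$$ where terms with $n_p=0$ are $0$. Theorem. There are an efficient algorithm and an absolute constant $C>0$ such that for all $d\ge1$, all $T\ge2$ and every sequence $(x_t,y_t)_{t\le T}$ in $\mathcal X\times\{0,1\}$, the predictions of the algorithm satisfy, for every $\delta\in(0,1)$, $$\mathsf{SMCal}_{\mathcal F_1^{\mathrm{lin}},1}\le C\Big(T^{2/3}d^{1/3}(\log T)^{1/3}+T^{2/3}(d\log T)^{-1/6}\sqrt{\log\tfrac1\delta}\Big)\quad\text{with probability at least }1-\delta,$$ and $$\mathbb E\big[\mathsf{SMCal}_{\mathcal F_1^{\mathrm{lin}},1}\big]\le C\,T^{2/3}d^{1/3}(\log T)^{1/3},$$ where probability and expectation are over the algorithm's internal randomness. The algorithm does not depend on $\delta$. "Efficient" means that one fixed program, the same for all $d$ and $T$, using exact arithmetic operations and comparisons of real numbers at unit cost, computes $N$ and the probabilities $\mathcal P_t(p)$, $p\in\mathcal Z$, in every round $t\le T$ from $d$, $T$, $x_1,\dots,x_t$, $y_1,\dots,y_{t-1}$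 in a number of steps polynomial in $d$ and $T$. -/

import Mathlib

open MeasureTheory

noncomputable section

namespace SwapMulticalibration

/-! ### Contexts, labels, hypotheses -/

/-- The context set: points of the closed Euclidean unit ball of `ℝ^d` whose first coordinate
is `1/2`. -/
def Context (d : ℕ) [NeZero d] : Set (EuclideanSpace ℝ (Fin d)) :=
  {x | ‖x‖ ≤ 1 ∧ x 0 = 1 / 2}

/-- The label set `{0, 1}`. -/
def Label : Set ℝ := {0, 1}

/-- The linear functions `x ↦ ⟨θ, x⟩` on the context set. -/
def linClass (d : ℕ) [NeZero d] : Set (Context d → ℝ) :=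
  {f | ∃ θ : EuclideanSpace ℝ (Fin d), ∀ x, f x = inner ℝ θ (x : EuclideanSpace ℝ (Fin d))}

/-- The members `f` of a hypothesis class with `f(x)^2 ≤ β` for all `x`. -/
def bounded {X : Type*} (F : Set (X → ℝ)) (β : ℝ) : Set (X → ℝ) :=
  {f | f ∈ F ∧ ∀ x, f x ^ 2 ≤ β}

/-! ### Swap multicalibration error

Predictions lie in `{0, 1/N, …, 1}`; the prediction `i / N` is represented by its index
`i : Fin (N + 1)`. -/

/-- The prediction `i / N`. -/
def grid {N : ℕ} (i : Fin (N + 1)) : ℝ := (i : ℝ) / (N : ℝ)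

section Error

variable {X : Type*} {N T : ℕ}

/-- The number of rounds in which the prediction was `i / N`. -/
def count (p : Fin T → Fin (N + 1)) (i : Fin (N + 1)) : ℝ :=
  ∑ t, if p t = i then (1 : ℝ) else 0

/-- The average of `f(x_t) (y_t - p)` over the rounds with prediction `p = i / N`
(it is `0` if there are none, and is then multiplied by `0` below). -/
def corr (x : Fin T → X) (y : Fin T → Label) (p : Fin T → Fin (N + 1)) (i : Fin (N + 1))
    (f : X → ℝ) : ℝ :=
  (∑ t, (if p t = i then (1 : ℝ) else 0) * f (x t) * ((y t : ℝ) - grid i)) / count p i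

/-- The `ℓ_q`-swap multicalibration error: the supremum over comparator profiles, one
hypothesis for every possible prediction. -/
def swapMulticalError (F : Set (X → ℝ)) (q : ℕ) (x : Fin T → X) (y : Fin T → Label)
    (p : Fin T → Fin (N + 1)) : ℝ :=
  ⨆ f : Fin (N + 1) → F, ∑ i, count p i * |corr x y p i (f i)| ^ q

end Error

/-! ### Forecasters and the online protocol -/

/-- A forecaster: in round `t` (counted from `0`) it sees the contexts `x_0, …, x_t` and the
labels `y_0, …, y_{t-1}`, and it chooses a distribution on `{0, 1/N, …, 1}`, from which the
prediction is drawn. -/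
structure Forecaster (d : ℕ) [NeZero d] where
  N : ℕ
  N_pos : 0 < N
  predict : (t : ℕ) → (Fin (t + 1) → Context d) → (Fin t → Label) → PMF (Fin (N + 1))

/-- The distribution of the prediction in round `t` against the fixed sequence `(x, y)`. -/
def Forecaster.dist {d T : ℕ} [NeZero d] (A : Forecaster d) (x : Fin T → Context d)
    (y : Fin T → Label) (t : Fin T) : PMF (Fin (A.N + 1)) :=
  A.predict t (fun s => x ⟨s, by omega⟩) (fun s => y ⟨s, by omega⟩)

/-- The law of the predictions `p_0, …, p_{T-1}` against the fixed sequence `(x, y)`. As the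
distribution of each prediction is determined by `(x, y)`, the predictions are independent. -/
def Forecaster.law {d T : ℕ} [NeZero d] (A : Forecaster d) (x : Fin T → Context d)
    (y : Fin T → Label) : Measure (Fin T → Fin (A.N + 1)) :=
  Measure.pi fun t => (A.dist x y t).toMeasure

/-! ### Programs over the reals with a step count

A small imperative language with counters (natural numbers) and two-dimensional arrays of real
numbers. It has exact arithmetic and comparison of reals at unit cost, no real constants other
than those obtained from natural numbers, and bounded loops. -/

/-- Contents of the memory: counters, and cells `(i, j)` of arrays. -/
structure Memory where
  counter : ℕ → ℕ
  cell : ℕ → ℕ → ℕ → ℝ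

/-- Store a value in a counter. -/
def Memory.setCounter (m : Memory) (v n : ℕ) : Memory :=
  { m with counter := Function.update m.counter v n }

/-- Store a value in cell `(i, j)` of array `a`. -/
def Memory.setCell (m : Memory) (a i j : ℕ) (r : ℝ) : Memory :=
  { m with cell := fun a' i' j' => if a' = a ∧ i' = i ∧ j' = j then r else m.cell a' i' j' }

/-- Expressions over the counters; subtraction is truncated. -/
inductive CounterExpr where
  | const (n : ℕ)
  | var (v : ℕ)
  | add (e₁ e₂ : CounterExpr)
  | sub (e₁ e₂ : CounterExpr)
  | mul (e₁ e₂ : CounterExpr)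

def CounterExpr.eval (m : Memory) : CounterExpr → ℕ
  | const n => n
  | var v => m.counter v
  | add e₁ e₂ => e₁.eval m + e₂.eval m
  | sub e₁ e₂ => e₁.eval m - e₂.eval m
  | mul e₁ e₂ => e₁.eval m * e₂.eval m

/-- The number of operations in an expression. -/
def CounterExpr.cost : CounterExpr → ℕ
  | const _ => 1
  | var _ => 1
  | add e₁ e₂ => e₁.cost + e₂.cost + 1
  | sub e₁ e₂ => e₁.cost + e₂.cost + 1
  | mul e₁ e₂ => e₁.cost + e₂.cost + 1

/-- Real expressions; division by `0` gives `0`. -/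
inductive RealExpr where
  | ofCounter (e : CounterExpr)
  | cell (a : ℕ) (i j : CounterExpr)
  | add (e₁ e₂ : RealExpr)
  | sub (e₁ e₂ : RealExpr)
  | mul (e₁ e₂ : RealExpr)
  | div (e₁ e₂ : RealExpr)

def RealExpr.eval (m : Memory) : RealExpr → ℝ
  | ofCounter e => (e.eval m : ℝ)
  | cell a i j => m.cell a (i.eval m) (j.eval m)
  | add e₁ e₂ => e₁.eval m + e₂.eval m
  | sub e₁ e₂ => e₁.eval m - e₂.eval m
  | mul e₁ e₂ => e₁.eval m * e₂.eval m
  | div e₁ e₂ => e₁.eval m / e₂.eval m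

/-- The number of operations in an expression. -/
def RealExpr.cost : RealExpr → ℕ
  | ofCounter e => e.cost + 1
  | cell _ i j => i.cost + j.cost + 1
  | add e₁ e₂ => e₁.cost + e₂.cost + 1
  | sub e₁ e₂ => e₁.cost + e₂.cost + 1
  | mul e₁ e₂ => e₁.cost + e₂.cost + 1
  | div e₁ e₂ => e₁.cost + e₂.cost + 1

/-- Programs. `loop v e c` evaluates `e` once and then runs `c` with the counter `v` set to
`0, 1, …, e - 1` in turn. -/
inductive Program where
  | skip
  | setCounter (v : ℕ) (e : CounterExpr)
  | setCell (a : ℕ) (i j : CounterExpr) (e : RealExpr)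
  | seq (c₁ c₂ : Program)
  | ifLE (e₁ e₂ : RealExpr) (c₁ c₂ : Program)
  | loop (v : ℕ) (e : CounterExpr) (c : Program)

/-- The memory after the first `n` passes of a loop with loop counter `v` and a body that acts
on the memory as `body`. -/
def loopRun (v : ℕ) (body : Memory → Memory) (m : Memory) : ℕ → Memory
  | 0 => m
  | n + 1 => body ((loopRun v body m n).setCounter v n)

open Classical in
/-- The memory after a run of the program. -/
def Program.run : Program → Memory → Memory
  | skip, m => m
  | setCounter v e, m => m.setCounter v (e.eval m)
  | setCell a i j e, m => m.setCell a (i.eval m) (j.eval m) (e.eval m)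
  | seq c₁ c₂, m => c₂.run (c₁.run m)
  | ifLE e₁ e₂ c₁ c₂, m => if e₁.eval m ≤ e₂.eval m then c₁.run m else c₂.run m
  | loop v e c, m => loopRun v c.run m (e.eval m)

open Classical in
/-- The number of steps of a run of the program. -/
def Program.steps : Program → Memory → ℕ
  | skip, _ => 1
  | setCounter _ e, _ => e.cost + 1
  | setCell _ i j e, _ => i.cost + j.cost + e.cost + 1
  | seq c₁ c₂, m => c₁.steps m + c₂.steps (c₁.run m)
  | ifLE e₁ e₂ c₁ c₂, m =>
      e₁.cost + e₂.cost + 1 + if e₁.eval m ≤ e₂.eval m then c₁.steps m else c₂.steps m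
  | loop v e c, m =>
      e.cost + 1 +
        ∑ k ∈ Finset.range (e.eval m), (1 + c.steps ((loopRun v c.run m k).setCounter v k))

/-- The input in round `t`: the counters `0, 1, 2` hold `d`, `T`, `t`; row `s` of array `0` holds
the context `x_s` (`s ≤ t`), cell `(s, 0)` of array `1` holds the label `y_s` (`s < t`);
everything else is `0`. -/
def input {d : ℕ} [NeZero d] (T t : ℕ) (x : Fin (t + 1) → Context d) (y : Fin t → Label) :
    Memory where
  counter v := if v = 0 then d else if v = 1 then T else if v = 2 then t else 0
  cell a i j :=
    if a = 0 then
      if h : i < t + 1 ∧ j < d then (x ⟨i, h.1⟩ : EuclideanSpace ℝ (Fin d)) ⟨j, h.2⟩ else 0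
    else if a = 1 then
      if h : i < t ∧ j = 0 then (y ⟨i, h.1⟩ : ℝ) else 0
    else 0

/-- A family of forecasters, indexed by the dimension `d` and the horizon `T`, is efficient if a
single program computes, from the observations available in a round, the number `N` (in counter
`3`) and the probabilities of the predictions `0, 1/N, …, 1` in that round (in the cells `(i, 0)`
of array `2`), in a number of steps per round that is polynomial in `d` and `T`. -/
def Efficient (A : (d T : ℕ) → [NeZero d] → Forecaster d) : Prop :=
  ∃ (c : Program) (K k : ℕ), ∀ (d T : ℕ) [NeZero d] (t : ℕ), t < T →
    ∀ (x : Fin (t + 1) → Context d) (y : Fin t → Label),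
      (c.run (input T t x y)).counter 3 = (A d T).N ∧
      (∀ i : Fin ((A d T).N + 1),
        (c.run (input T t x y)).cell 2 i 0 = ((A d T).predict t x y i).toReal) ∧
      c.steps (input T t x y) ≤ K * (d + T) ^ k

end SwapMulticalibration

end

/-! A linear function bounded by 1 on the contexts has a parameter of norm at most 2
(`norm_le_two_of_abs_inner_le`). By Cauchy–Schwarz the supremum over comparator profiles is
therefore at most twice `residual`, the sum over grid points p of the norm of ∑_t 1[p_t = p] (y_t −
p) x_t. Bounding this sum never involves the dimension: its expectation is O(T^{2/3}), which the
stated rate dominates up to a constant.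

Each grid point i/N carries a vector w_i, moved by online gradient ascent with step 1/N on the gain
P_t(i) (y_t − i/N) ⟨w_i, x_t⟩. Ascent bounds the norm of ∑_t P_t(i) (y_t − i/N) x_t by the
accumulated gain plus a regret (`sum_inner_le`). The distribution P_t keeps the total gain small
against either label: where the score ⟨w_i, x_t⟩ changes sign between two neighbours, it balances
them so that the label cancels and only the mesh 1/N is left (`sum_mix_mul_le`). Summed over the
grid this is O(N² + T/N) (`sum_norm_sum_prob_le`). Passing from probabilities to drawn predictions
costs the same order, by a second-moment bound for each grid point (`integral_residual_le`), and N ≈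
T^{1/3} balances the terms.

For the tail, one prediction influences `residual` by at most 2, so McDiarmid's inequality gives a
deviation of order √(T log(1/δ)). This is covered by the second term of the claim when d log T ≤ T;
otherwise the first term already exceeds the trivial bound T.

For efficiency, a program with arithmetic and comparisons only replays the whole history in each
round. Exact projection onto the ball would need a square root; `pull` is a rational substitute that
never increases the distance to points of the unit ball and keeps the weights bounded. -/

namespace SwapMulticalibration

/-! ### Frames and step counts of programs -/

namespace Program

/-- The program does not write to counter `v`. -/
def KeepsCounter (v : ℕ) : Program → Prop
  | skip => True
  | setCounter w _ => w ≠ v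
  | setCell _ _ _ _ => True
  | seq c₁ c₂ => c₁.KeepsCounter v ∧ c₂.KeepsCounter v
  | ifLE _ _ c₁ c₂ => c₁.KeepsCounter v ∧ c₂.KeepsCounter v
  | loop w _ c => w ≠ v ∧ c.KeepsCounter v

/-- The program does not write to array `a`. -/
def KeepsArray (a : ℕ) : Program → Prop
  | skip => True
  | setCounter _ _ => True
  | setCell b _ _ _ => b ≠ a
  | seq c₁ c₂ => c₁.KeepsArray a ∧ c₂.KeepsArray a
  | ifLE _ _ c₁ c₂ => c₁.KeepsArray a ∧ c₂.KeepsArray a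
  | loop _ _ c => c.KeepsArray a

/-- Every loop of the program is bounded by one of the counters in `S`. -/
def LoopsOver (S : List ℕ) : Program → Prop
  | skip => True
  | setCounter _ _ => True
  | setCell _ _ _ _ => True
  | seq c₁ c₂ => c₁.LoopsOver S ∧ c₂.LoopsOver S
  | ifLE _ _ c₁ c₂ => c₁.LoopsOver S ∧ c₂.LoopsOver S
  | loop _ e c => (∃ v ∈ S, e = .var v) ∧ c.LoopsOver S

/-- A bound for the number of steps when no loop makes more than `B` passes. -/
def stepBound (B : ℕ) : Program → ℕ
  | skip => 1
  | setCounter _ e => e.cost + 1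
  | setCell _ i j e => i.cost + j.cost + e.cost + 1
  | seq c₁ c₂ => c₁.stepBound B + c₂.stepBound B
  | ifLE e₁ e₂ c₁ c₂ => e₁.cost + e₂.cost + 1 + (c₁.stepBound B + c₂.stepBound B)
  | loop _ e c => e.cost + 1 + B * (1 + c.stepBound B)

theorem counter_run {v : ℕ} {c : Program} (h : c.KeepsCounter v) (m : Memory) :
    (c.run m).counter v = m.counter v := by
  induction c generalizing m with
  | skip => rfl
  | setCounter w e =>
    simp only [KeepsCounter] at h
    simp [run, Memory.setCounter, Function.update_of_ne h.symm]
  | setCell a i j e => rfl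
  | seq c₁ c₂ ih₁ ih₂ => rw [run, ih₂ h.2, ih₁ h.1]
  | ifLE e₁ e₂ c₁ c₂ ih₁ ih₂ =>
    rw [run]
    split_ifs
    exacts [ih₁ h.1 m, ih₂ h.2 m]
  | loop w e c ih =>
    rw [run]
    induction e.eval m with
    | zero => rfl
    | succ n hn =>
      rw [loopRun, ih h.2, ← hn]
      simp [Memory.setCounter, Function.update_of_ne h.1.symm]

theorem cell_run {a : ℕ} {c : Program} (h : c.KeepsArray a) (m : Memory) :
    (c.run m).cell a = m.cell a := by
  induction c generalizing m with
  | skip => rfl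
  | setCounter w e => rfl
  | setCell b i j e =>
    simp only [KeepsArray] at h
    simp [run, Memory.setCell, h.symm]
  | seq c₁ c₂ ih₁ ih₂ => rw [run, ih₂ h.2, ih₁ h.1]
  | ifLE e₁ e₂ c₁ c₂ ih₁ ih₂ =>
    rw [run]
    split_ifs
    exacts [ih₁ h.1 m, ih₂ h.2 m]
  | loop w e c ih =>
    rw [run]
    induction e.eval m with
    | zero => rfl
    | succ n hn =>
      rw [loopRun, ih h, ← hn]
      rfl

theorem counter_loopRun {v w : ℕ} {c : Program} (hw : w ≠ v) (h : c.KeepsCounter v)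
    (m : Memory) (n : ℕ) : (loopRun w c.run m n).counter v = m.counter v := by
  induction n with
  | zero => rfl
  | succ n hn =>
    rw [loopRun, counter_run h, ← hn]
    simp [Memory.setCounter, Function.update_of_ne hw.symm]

/-- The counters in `S` are never written, so their initial values bound every loop at every depth
of nesting. -/
theorem steps_le_stepBound {S : List ℕ} {B : ℕ} {c : Program} (hl : c.LoopsOver S)
    (hk : ∀ v ∈ S, c.KeepsCounter v) (m : Memory) (hm : ∀ v ∈ S, m.counter v ≤ B) :
    c.steps m ≤ c.stepBound B := by
  induction c generalizing m with
  | skip => exact le_rfl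
  | setCounter w e => exact le_rfl
  | setCell b i j e => exact le_rfl
  | seq c₁ c₂ ih₁ ih₂ =>
    refine add_le_add (ih₁ hl.1 (fun v hv => (hk v hv).1) m hm)
      (ih₂ hl.2 (fun v hv => (hk v hv).2) _ fun v hv => ?_)
    rw [counter_run (hk v hv).1]
    exact hm v hv
  | ifLE e₁ e₂ c₁ c₂ ih₁ ih₂ =>
    have h₁ := ih₁ hl.1 (fun v hv => (hk v hv).1) m hm
    have h₂ := ih₂ hl.2 (fun v hv => (hk v hv).2) m hm
    rw [steps, stepBound]
    split_ifs <;> omega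
  | loop w e c ih =>
    obtain ⟨⟨v, hv, rfl⟩, hl⟩ := hl
    rw [steps, stepBound]
    refine Nat.add_le_add_left ?_ _
    calc _ ≤ ∑ k ∈ Finset.range (m.counter v), (1 + c.stepBound B) := by
          refine Finset.sum_le_sum fun k _ => Nat.add_le_add_left ?_ _
          refine ih hl (fun u hu => (hk u hu).2) _ fun u hu => ?_
          have := counter_loopRun (hk u hu).1 (hk u hu).2 m k
          simp only [Memory.setCounter, Function.update_of_ne (hk u hu).1.symm]
          rw [this]
          exact hm u hu
      _ ≤ _ := by
          rw [Finset.sum_const, Finset.card_range, smul_eq_mul]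
          exact Nat.mul_le_mul_right _ (hm v hv)

/-- `stepBound` is a polynomial in `B` whose degree is the nesting depth of the loops; `1 ≤ B` lets
different powers be compared. -/
theorem exists_stepBound_le (c : Program) :
    ∃ K k : ℕ, ∀ B : ℕ, 1 ≤ B → c.stepBound B ≤ K * B ^ k := by
  have two : ∀ {f g : ℕ → ℕ}, (∃ K k : ℕ, ∀ B, 1 ≤ B → f B ≤ K * B ^ k) →
      (∃ K k : ℕ, ∀ B, 1 ≤ B → g B ≤ K * B ^ k) →
      ∃ K k : ℕ, ∀ B, 1 ≤ B → f B + g B ≤ K * B ^ k := by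
    rintro f g ⟨K, k, h⟩ ⟨L, l, h'⟩
    refine ⟨K + L, k + l, fun B hB => ?_⟩
    have h₁ : K * B ^ k ≤ K * B ^ (k + l) :=
      Nat.mul_le_mul_left _ (Nat.pow_le_pow_right hB (by omega))
    have h₂ : L * B ^ l ≤ L * B ^ (k + l) :=
      Nat.mul_le_mul_left _ (Nat.pow_le_pow_right hB (by omega))
    rw [add_mul]
    exact add_le_add ((h B hB).trans h₁) ((h' B hB).trans h₂)
  have one : ∀ n : ℕ, ∃ K k : ℕ, ∀ B : ℕ, 1 ≤ B → n ≤ K * B ^ k :=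
    fun n => ⟨n, 0, fun B _ => by simp⟩
  induction c with
  | skip => exact one _
  | setCounter w e => exact one _
  | setCell b i j e => exact one _
  | seq c₁ c₂ ih₁ ih₂ => exact two ih₁ ih₂
  | ifLE e₁ e₂ c₁ c₂ ih₁ ih₂ => exact two (one _) (two ih₁ ih₂)
  | loop w e c ih =>
    refine two (one _) ?_
    obtain ⟨K, k, h⟩ := two (one 1) ih
    refine ⟨K, k + 1, fun B hB => ?_⟩
    calc B * (1 + c.stepBound B) ≤ B * (K * B ^ k) := Nat.mul_le_mul_left _ (h B hB)
      _ = _ := by ring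

end Program

/-! ### The forecasting rule -/

/-- One more than the last index below `n` at which `a` is positive; `0` if there is none. -/
noncomputable def lastPos (a : ℕ → ℝ) : ℕ → ℕ
  | 0 => 0
  | n + 1 => if a n ≤ 0 then lastPos a n else n + 1

/-- The weight of the prediction `i / N` in a distribution that nearly balances the scores `a`:
it is supported on two neighbours between which `a` changes its sign. -/
noncomputable def mix (N : ℕ) (a : ℕ → ℝ) (i : ℕ) : ℝ :=
  if lastPos a (N + 1) = 0 then if i = 0 then 1 else 0
  else if lastPos a (N + 1) = N + 1 then if i = N then 1 else 0
  else
    if i = lastPos a (N + 1) then a (i - 1) / (a (i - 1) - a i)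
    else if i = lastPos a (N + 1) - 1 then a (i + 1) / (a (i + 1) - a i)
    else 0

theorem lastPos_le (a : ℕ → ℝ) (n : ℕ) : lastPos a n ≤ n := by
  induction n with
  | zero => exact le_rfl
  | succ n ih => rw [lastPos]; split_ifs <;> omega

theorem pos_of_lastPos (a : ℕ → ℝ) (n : ℕ) (h : lastPos a n ≠ 0) : 0 < a (lastPos a n - 1) := by
  induction n with
  | zero => exact absurd rfl h
  | succ n ih =>
    rw [lastPos] at h ⊢
    split_ifs with hn
    · rw [if_pos hn] at h
      exact ih h
    · simpa using hn

theorem nonpos_of_lastPos_le (a : ℕ → ℝ) {n i : ℕ} (hi : lastPos a n ≤ i) (hn : i < n) :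
    a i ≤ 0 := by
  induction n with
  | zero => omega
  | succ n ih =>
    rw [lastPos] at hi
    split_ifs at hi with h
    · rcases Nat.lt_succ_iff_lt_or_eq.1 hn with h' | rfl
      exacts [ih hi h', h]
    · omega

/-- At either end of the grid the residual y − p has the same weak sign for all labels, opposite to
the score there, so a point mass suffices. Two points are needed only at an interior sign change. -/
theorem mix_cases (N : ℕ) (a : ℕ → ℝ) :
    (a 0 ≤ 0 ∧ ∀ i, mix N a i = if i = 0 then 1 else 0) ∨
    (0 < a N ∧ ∀ i, mix N a i = if i = N then 1 else 0) ∨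
    ∃ k, k < N ∧ 0 < a k ∧ a (k + 1) ≤ 0 ∧
      ∀ i, mix N a i = (if i = k then a (k + 1) / (a (k + 1) - a k) else 0) +
        (if i = k + 1 then a k / (a k - a (k + 1)) else 0) := by
  by_cases h0 : lastPos a (N + 1) = 0
  · exact .inl ⟨nonpos_of_lastPos_le a (n := N + 1) (by omega) (by omega),
      fun i => by rw [mix, if_pos h0]⟩
  have hp := pos_of_lastPos a _ h0
  by_cases hN : lastPos a (N + 1) = N + 1
  · rw [hN] at hp
    exact .inr (.inl ⟨hp, fun i => by rw [mix, if_neg h0, if_pos hN]⟩)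
  · have hle := lastPos_le a (N + 1)
    refine .inr (.inr ⟨lastPos a (N + 1) - 1, by omega, hp,
      nonpos_of_lastPos_le a (n := N + 1) (by omega) (by omega), fun i => ?_⟩)
    rw [mix, if_neg h0, if_neg hN]
    obtain ⟨k, hk⟩ : ∃ k, lastPos a (N + 1) = k + 1 := ⟨lastPos a (N + 1) - 1, by omega⟩
    rw [hk, Nat.add_sub_cancel]
    by_cases h₁ : i = k + 1
    · subst h₁; simp
    · by_cases h₂ : i = k
      · subst h₂; simp
      · simp [h₁, h₂]

theorem mix_nonneg (N : ℕ) (a : ℕ → ℝ) (i : ℕ) : 0 ≤ mix N a i := by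
  rcases mix_cases N a with ⟨-, h⟩ | ⟨-, h⟩ | ⟨k, -, hp, hn, h⟩
  · rw [h]; split_ifs <;> norm_num
  · rw [h]; split_ifs <;> norm_num
  · rw [h]
    have h₁ : 0 ≤ a (k + 1) / (a (k + 1) - a k) := div_nonneg_of_nonpos hn (by linarith)
    have h₂ : 0 ≤ a k / (a k - a (k + 1)) := div_nonneg hp.le (by linarith)
    refine add_nonneg ?_ ?_ <;> split_ifs <;> first | assumption | exact le_rfl

theorem sum_mix (N : ℕ) (a : ℕ → ℝ) : ∑ i ∈ Finset.range (N + 1), mix N a i = 1 := by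
  rcases mix_cases N a with ⟨-, h⟩ | ⟨-, h⟩ | ⟨k, hk, hp, hn, h⟩
  · simp [h]
  · simp [h]
  · have h₁ : k < N + 1 := by omega
    simp only [h, Finset.sum_add_distrib, Finset.sum_ite_eq', Finset.mem_range, h₁,
      Nat.succ_lt_succ hk, if_true]
    rw [← neg_sub (a k), div_neg, ← neg_div, ← add_div]
    have : a k - a (k + 1) ≠ 0 := by linarith
    field_simp
    ring

theorem mix_le_one (N : ℕ) (a : ℕ → ℝ) {i : ℕ} (hi : i < N + 1) : mix N a i ≤ 1 := by
  rw [← sum_mix N a]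
  exact Finset.single_le_sum (fun j _ => mix_nonneg N a j) (Finset.mem_range.2 hi)

/-- Whatever the label is, the expected score is at most of the order of the grid width. -/
theorem sum_mix_mul_le {N : ℕ} (hN : 0 < N) (a : ℕ → ℝ) {B y : ℝ}
    (ha : ∀ i < N + 1, |a i| ≤ B) (hy0 : 0 ≤ y) (hy1 : y ≤ 1) :
    ∑ i ∈ Finset.range (N + 1), mix N a i * (y - i / N) * a i ≤ B / N := by
  have hB : 0 ≤ B := (abs_nonneg _).trans (ha 0 (by omega))
  have hN' : (0 : ℝ) < N := by exact_mod_cast hN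
  have hBN : 0 ≤ B / N := by positivity
  rcases mix_cases N a with ⟨h0, h⟩ | ⟨h0, h⟩ | ⟨k, hk, hp, hn, h⟩
  · simp only [h, ite_mul, one_mul, zero_mul, Finset.sum_ite_eq', Finset.mem_range]
    simp only [Nat.zero_lt_succ, if_true, Nat.cast_zero, zero_div, sub_zero]
    nlinarith
  · simp only [h, ite_mul, one_mul, zero_mul, Finset.sum_ite_eq', Finset.mem_range,
      Nat.lt_succ_self, if_true, div_self hN'.ne']
    nlinarith
  · have h₁ : k < N + 1 := by omega
    simp only [h, add_mul, ite_mul, zero_mul, Finset.sum_add_distrib, Finset.sum_ite_eq',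
      Finset.mem_range, h₁, Nat.succ_lt_succ hk, if_true]
    have hd : 0 < a k - a (k + 1) := by linarith
    -- The two probabilities make weight times score opposite at `k` and `k + 1`, so `y` cancels and
    -- the grid gap 1/N remains.
    have e : a (k + 1) / (a (k + 1) - a k) * (y - k / N) * a k +
        a k / (a k - a (k + 1)) * (y - (k + 1 : ℕ) / N) * a (k + 1) =
        a k * (-a (k + 1) / (a k - a (k + 1))) / N := by
      rw [← neg_sub (a k), div_neg, Nat.cast_succ]
      field_simp
      ring
    rw [e]
    have h₂ : -a (k + 1) / (a k - a (k + 1)) ≤ 1 := by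
      rw [div_le_one hd]; linarith
    have h₃ : 0 ≤ -a (k + 1) / (a k - a (k + 1)) := div_nonneg (by linarith) hd.le
    have h₄ : a k ≤ B := (le_abs_self _).trans (ha k h₁)
    gcongr
    nlinarith

/-! ### Online gradient ascent with an approximate projection. -/

section Weights

variable {E : Type*} [NormedAddCommGroup E] [InnerProductSpace ℝ E]

/-- A step of Newton's method towards the projection onto the unit ball. -/
noncomputable def pull (u : E) : E :=
  if ‖u‖ ^ 2 ≤ 1 then u else ((1 + ‖u‖ ^ 2) / (2 * ‖u‖ ^ 2)) • u

/-- Weights of norm at most 2 move by at most 1 in a round, so this restores the invariant. Outside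
the ball the new norm is (r + 1/r)/2 with r = ‖u‖. -/
theorem norm_pull_le {u : E} (hu : ‖u‖ ≤ 3) : ‖pull u‖ ≤ 2 := by
  have h0 := norm_nonneg u
  rw [pull]
  split_ifs with h
  · nlinarith
  · have h1 : 1 < ‖u‖ := by nlinarith
    rw [norm_smul, Real.norm_of_nonneg (by positivity), div_mul_eq_mul_div,
      div_le_iff₀ (by positivity)]
    nlinarith [mul_nonneg (sub_nonneg.2 h1.le) (sub_nonneg.2 hu)]

/-- By AM–GM the rescaled vector does not cross the unit sphere, and moving radially inwards down to
the sphere brings a vector no farther from any point of the ball. This is all the regret analysis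
asks of a projection. -/
theorem norm_pull_sub_sq_le (u : E) {v : E} (hv : ‖v‖ ≤ 1) :
    ‖pull u - v‖ ^ 2 ≤ ‖u - v‖ ^ 2 := by
  rw [pull]
  split_ifs with h
  · exact le_rfl
  · have h0 := norm_nonneg u
    have h1 : 1 < ‖u‖ := by nlinarith
    set s := (1 + ‖u‖ ^ 2) / (2 * ‖u‖ ^ 2) with hs
    have hs1 : s ≤ 1 := by
      rw [hs, div_le_one (by positivity)]; nlinarith
    have hsu : 1 ≤ s * ‖u‖ := by
      rw [hs, div_mul_eq_mul_div, one_le_div (by positivity)]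
      nlinarith [mul_nonneg h0 (sq_nonneg (‖u‖ - 1))]
    have hi : inner ℝ u v ≤ ‖u‖ := (real_inner_le_norm u v).trans (by nlinarith)
    rw [norm_sub_sq_real, norm_sub_sq_real, norm_smul, mul_pow, Real.norm_eq_abs, sq_abs,
      real_inner_smul_left]
    nlinarith [mul_nonneg (sub_nonneg.2 hs1) (sub_nonneg.2 hi),
      mul_nonneg (sub_nonneg.2 hs1) (mul_nonneg h0 (sub_nonneg.2 hsu)),
      mul_nonneg (sub_nonneg.2 hs1) (mul_nonneg h0 (sub_nonneg.2 h1.le))]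

/-- The new weights after the context `x` and the label `y` have been seen. -/
noncomputable def nextWeights (N : ℕ) (w : ℕ → E) (x : E) (y : ℝ) (i : ℕ) : E :=
  pull (w i + (mix N (fun j => inner ℝ (w j) x) i * (y - i / N) / N) • x)

/-- The weights of the predictions after `t` rounds of projected gradient ascent. -/
noncomputable def weights (N : ℕ) (X : ℕ → E) (Y : ℕ → ℝ) : ℕ → ℕ → E
  | 0 => fun _ => 0
  | t + 1 => nextWeights N (weights N X Y t) (X t) (Y t)

/-- The probability of the prediction `i / N` in round `t`. -/
noncomputable def prob (N : ℕ) (X : ℕ → E) (Y : ℕ → ℝ) (t i : ℕ) : ℝ :=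
  mix N (fun j => inner ℝ (weights N X Y t j) (X t)) i

theorem prob_nonneg (N : ℕ) (X : ℕ → E) (Y : ℕ → ℝ) (t i : ℕ) : 0 ≤ prob N X Y t i :=
  mix_nonneg _ _ _

theorem weights_congr (N : ℕ) {X X' : ℕ → E} {Y Y' : ℕ → ℝ} {t : ℕ}
    (hX : ∀ s < t, X s = X' s) (hY : ∀ s < t, Y s = Y' s) :
    weights N X Y t = weights N X' Y' t := by
  induction t with
  | zero => rfl
  | succ t ih =>
    rw [weights, weights, ih (fun s hs => hX s (by omega)) (fun s hs => hY s (by omega)),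
      hX t (by omega), hY t (by omega)]

theorem prob_congr (N : ℕ) {X X' : ℕ → E} {Y Y' : ℕ → ℝ} {t : ℕ}
    (hX : ∀ s ≤ t, X s = X' s) (hY : ∀ s < t, Y s = Y' s) :
    prob N X Y t = prob N X' Y' t := by
  funext i
  rw [prob, prob, weights_congr N (fun s hs => hX s hs.le) hY, hX t le_rfl]

theorem weights_succ (N : ℕ) (X : ℕ → E) (Y : ℕ → ℝ) (t i : ℕ) :
    weights N X Y (t + 1) i =
      pull (weights N X Y t i + (prob N X Y t i * (Y t - i / N) / N) • X t) := rfl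

theorem abs_label_sub_le {y : ℝ} (hy0 : 0 ≤ y) (hy1 : y ≤ 1) {N i : ℕ} (hi : i < N + 1) :
    |y - i / N| ≤ 1 := by
  have h1 : (i : ℝ) / N ≤ 1 :=
    div_le_one_of_le₀ (by exact_mod_cast Nat.lt_succ_iff.1 hi) (by positivity)
  have h0 : (0 : ℝ) ≤ i / N := by positivity
  rw [abs_le]
  constructor <;> linarith

theorem abs_prob_mul_le (N : ℕ) (X : ℕ → E) (Y : ℕ → ℝ) (t : ℕ) (hy0 : 0 ≤ Y t)
    (hy1 : Y t ≤ 1) {i : ℕ} (hi : i < N + 1) :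
    |prob N X Y t i * (Y t - i / N)| ≤ prob N X Y t i := by
  have h := prob_nonneg N X Y t i
  rw [abs_mul, abs_of_nonneg h]
  exact mul_le_of_le_one_right h (abs_label_sub_le hy0 hy1 hi)

theorem norm_weights_le {N : ℕ} (hN : 0 < N) {X : ℕ → E} {Y : ℕ → ℝ} {T : ℕ}
    (hX : ∀ s < T, ‖X s‖ ≤ 1) (hY0 : ∀ s < T, 0 ≤ Y s) (hY1 : ∀ s < T, Y s ≤ 1)
    {t : ℕ} (ht : t ≤ T) {i : ℕ} (hi : i < N + 1) : ‖weights N X Y t i‖ ≤ 2 := by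
  induction t with
  | zero => simp [weights]
  | succ t ih =>
    rw [weights_succ]
    refine norm_pull_le ((norm_add_le _ _).trans ?_)
    have h1 := ih (by omega)
    have h2 : |prob N X Y t i * (Y t - i / N)| ≤ 1 :=
      (abs_prob_mul_le N X Y t (hY0 t ht) (hY1 t ht) hi).trans (mix_le_one _ _ hi)
    have h3 : ‖(prob N X Y t i * (Y t - i / N) / N) • X t‖ ≤ 1 := by
      rw [norm_smul, Real.norm_eq_abs, abs_div, Nat.abs_cast]
      have h4 : |prob N X Y t i * (Y t - i / N)| / N ≤ 1 :=
        (div_le_self (abs_nonneg _) (by exact_mod_cast hN)).trans h2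
      exact mul_le_one₀ h4 (norm_nonneg _) (hX t ht)
    linarith

/-- The regret bound of projected gradient ascent against one comparator. -/
theorem sum_inner_le {N : ℕ} (hN : 0 < N) {X : ℕ → E} {Y : ℕ → ℝ} (i : ℕ) {v : E}
    (hv : ‖v‖ ≤ 1) (t : ℕ) :
    2 * ∑ s ∈ Finset.range t, (prob N X Y s i * (Y s - i / N)) * inner ℝ v (X s) ≤
      N + ∑ s ∈ Finset.range t, (2 * ((prob N X Y s i * (Y s - i / N)) *
        inner ℝ (weights N X Y s i) (X s)) +
        ‖(prob N X Y s i * (Y s - i / N)) • X s‖ ^ 2 / N) := by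
  have hN' : (0 : ℝ) < N := by exact_mod_cast hN
  -- The potential is N‖w − v‖², the factor being the inverse step size. It starts at most at N
  -- because the weights start at 0.
  suffices h : N * ‖weights N X Y t i - v‖ ^ 2 +
      2 * ∑ s ∈ Finset.range t, (prob N X Y s i * (Y s - i / N)) * inner ℝ v (X s) ≤
      N + ∑ s ∈ Finset.range t, (2 * ((prob N X Y s i * (Y s - i / N)) *
        inner ℝ (weights N X Y s i) (X s)) +
        ‖(prob N X Y s i * (Y s - i / N)) • X s‖ ^ 2 / N) by
    have : 0 ≤ N * ‖weights N X Y t i - v‖ ^ 2 := by positivity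
    linarith
  induction t with
  | zero =>
    simp only [weights, zero_sub, norm_neg, Finset.range_zero, Finset.sum_empty, mul_zero, add_zero]
    have : ‖v‖ ^ 2 ≤ 1 := pow_le_one₀ (norm_nonneg _) hv
    nlinarith
  | succ t ih =>
    rw [Finset.sum_range_succ, Finset.sum_range_succ, weights_succ]
    set w := weights N X Y t i
    set c := prob N X Y t i * (Y t - i / N)
    have h1 := norm_pull_sub_sq_le (w + (c / N) • X t) hv
    have h2 : N * ‖w + (c / N) • X t - v‖ ^ 2 = N * ‖w - v‖ ^ 2 +
        2 * (c * inner ℝ w (X t)) - 2 * (c * inner ℝ v (X t)) + ‖c • X t‖ ^ 2 / N := by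
      rw [add_sub_right_comm, norm_add_sq_real, real_inner_smul_right, inner_sub_left, norm_smul,
        norm_smul, Real.norm_eq_abs, Real.norm_eq_abs, mul_pow, mul_pow, sq_abs, sq_abs]
      field_simp
      ring
    have h3 := mul_le_mul_of_nonneg_left h1 hN'.le
    rw [h2] at h3
    linarith

theorem exists_norm_eq_inner (u : E) : ∃ v : E, ‖v‖ ≤ 1 ∧ inner ℝ v u = ‖u‖ := by
  rcases eq_or_ne u 0 with rfl | h
  · exact ⟨0, by simp, by simp⟩
  · have h' : ‖u‖ ≠ 0 := norm_ne_zero_iff.2 h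
    refine ⟨‖u‖⁻¹ • u, by rw [norm_smul, norm_inv, norm_norm, inv_mul_cancel₀ h'], ?_⟩
    rw [real_inner_smul_left, real_inner_self_eq_norm_sq]
    field_simp

/-- The multicalibration error of the expected predictions. -/
theorem sum_norm_sum_prob_le {N : ℕ} (hN : 0 < N) {X : ℕ → E} {Y : ℕ → ℝ} {T : ℕ}
    (hX : ∀ s < T, ‖X s‖ ≤ 1) (hY0 : ∀ s < T, 0 ≤ Y s) (hY1 : ∀ s < T, Y s ≤ 1) :
    ∑ i ∈ Finset.range (N + 1),
      ‖∑ s ∈ Finset.range T, (prob N X Y s i * (Y s - i / N)) • X s‖ ≤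
      (N + 1) * N / 2 + 5 / 2 * (T / N) := by
  have hN' : (0 : ℝ) < N := by exact_mod_cast hN
  have key : ∀ i ∈ Finset.range (N + 1),
      2 * ‖∑ s ∈ Finset.range T, (prob N X Y s i * (Y s - i / N)) • X s‖ ≤
      N + ∑ s ∈ Finset.range T, (2 * ((prob N X Y s i * (Y s - i / N)) *
        inner ℝ (weights N X Y s i) (X s)) +
        ‖(prob N X Y s i * (Y s - i / N)) • X s‖ ^ 2 / N) := by
    intro i _
    obtain ⟨v, hv, h⟩ :=
      exists_norm_eq_inner (∑ s ∈ Finset.range T, (prob N X Y s i * (Y s - i / N)) • X s)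
    rw [← h, inner_sum]
    simp only [real_inner_smul_right]
    exact sum_inner_le hN i hv T
  have h1 := Finset.sum_le_sum key
  rw [← Finset.mul_sum, Finset.sum_add_distrib, Finset.sum_const, Finset.card_range,
    Finset.sum_comm, nsmul_eq_mul] at h1
  -- Scores are at most 2 in absolute value, so twice the gain is at most 4/N; the quadratic terms
  -- add 1/N.
  have h2 : ∀ s ∈ Finset.range T, ∑ i ∈ Finset.range (N + 1),
      (2 * ((prob N X Y s i * (Y s - i / N)) * inner ℝ (weights N X Y s i) (X s)) +
        ‖(prob N X Y s i * (Y s - i / N)) • X s‖ ^ 2 / N) ≤ (5 : ℝ) / N := by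
    intro s hs
    have hs := Finset.mem_range.1 hs
    rw [Finset.sum_add_distrib, ← Finset.mul_sum, ← Finset.sum_div]
    have h3 := sum_mix_mul_le hN (fun j => inner ℝ (weights N X Y s j) (X s)) (B := 2)
      (fun i hi => (abs_real_inner_le_norm _ _).trans (by
        have h4 := norm_weights_le hN hX hY0 hY1 hs.le hi
        have h5 := hX s hs
        nlinarith [norm_nonneg (X s), norm_nonneg (weights N X Y s i)])) (hY0 s hs) (hY1 s hs)
    -- Squared probabilities sum to at most 1 over the whole grid; this avoids a factor N in the
    -- regret.
    have h6 : ∑ i ∈ Finset.range (N + 1), ‖(prob N X Y s i * (Y s - i / N)) • X s‖ ^ 2 ≤ 1 := by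
      rw [← sum_mix N fun j => inner ℝ (weights N X Y s j) (X s)]
      refine Finset.sum_le_sum fun i hi => ?_
      have hi := Finset.mem_range.1 hi
      have h7 : ‖(prob N X Y s i * (Y s - i / N)) • X s‖ ≤ prob N X Y s i := by
        rw [norm_smul, Real.norm_eq_abs]
        exact (mul_le_of_le_one_right (abs_nonneg _) (hX s hs)).trans
          (abs_prob_mul_le N X Y s (hY0 s hs) (hY1 s hs) hi)
      have h8 : prob N X Y s i ≤ 1 := mix_le_one _ _ hi
      have h9 := norm_nonneg ((prob N X Y s i * (Y s - i / N)) • X s)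
      change _ ≤ prob N X Y s i
      nlinarith
    have h7 : (∑ i ∈ Finset.range (N + 1), ‖(prob N X Y s i * (Y s - i / N)) • X s‖ ^ 2) / N ≤
        1 / N := by gcongr
    have h8 : (5 : ℝ) / N = 2 * (2 / N) + 1 / N := by ring
    rw [h8]
    exact add_le_add (mul_le_mul_of_nonneg_left h3 two_pos.le) h7
  have h3 := Finset.sum_le_sum h2
  rw [Finset.sum_const, Finset.card_range, nsmul_eq_mul] at h3
  have h4 : (T : ℝ) * (5 / N) = 5 * (T / N) := by ring
  push_cast at h1
  linarith

end Weights

/-! ### Concentration for functions of independent predictions -/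

section Concentration

open ProbabilityTheory

variable {α : Type*} [Fintype α] [MeasurableSpace α] [MeasurableSingletonClass α]

/-- **McDiarmid's inequality**, exponential moments: a function on a finite product space that
changes by at most `c` when one coordinate changes. -/
theorem integral_exp_le_of_bounded_differences {c : ℝ} (hc : 0 ≤ c) (r : ℝ) {n : ℕ}
    (μ : Fin n → Measure α) [∀ t, IsProbabilityMeasure (μ t)] (f : (Fin n → α) → ℝ)
    (hf : ∀ p t a, |f (Function.update p t a) - f p| ≤ c) :
    ∫ p, Real.exp (r * (f p - ∫ q, f q ∂Measure.pi μ)) ∂Measure.pi μ ≤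
      Real.exp (n * (c ^ 2 * r ^ 2 / 2)) := by
  induction n with
  | zero =>
    have h : ∀ g : (Fin 0 → α) → ℝ, ∫ p, g p ∂Measure.pi μ = g default := fun g => by
      rw [Measure.pi_of_empty μ default, integral_dirac]
    rw [h, h]
    simp
  | succ n ih =>
    have hprod : ∀ g : (Fin (n + 1) → α) → ℝ, ∫ p, g p ∂Measure.pi μ =
        ∫ q, ∫ a, g (Fin.cons a q) ∂μ 0 ∂Measure.pi fun t => μ (Fin.succ t) := by
      intro g
      rw [← ((measurePreserving_piFinSuccAbove μ 0).symm).integral_comp', integral_prod_symm]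
      · simp only [MeasurableEquiv.piFinSuccAbove_symm_apply, Fin.insertNthEquiv_zero]
        rfl
      · exact Integrable.of_finite
    set ν := Measure.pi fun t => μ (Fin.succ t) with hν
    -- Averaging out the first coordinate preserves bounded differences, so the induction hypothesis
    -- applies to `g`.
    set g : (Fin n → α) → ℝ := fun q => ∫ a, f (Fin.cons a q) ∂μ 0 with hg
    have hgd : ∀ q t a, |g (Function.update q t a) - g q| ≤ c := by
      intro q t a
      rw [hg]
      simp only
      rw [← integral_sub Integrable.of_finite Integrable.of_finite]
      have := norm_integral_le_of_norm_le_const (μ := μ 0)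
        (f := fun b => f (Fin.cons b (Function.update q t a)) - f (Fin.cons b q)) (C := c)
        (.of_forall fun b => by
          rw [Fin.cons_update]
          exact hf _ _ _)
      simpa using this
    have hmean : ∫ q, f q ∂Measure.pi μ = ∫ q, g q ∂ν := hprod f
    rw [hprod, hmean]
    set M := ∫ q, g q ∂ν
    have hin : ∀ q, ∫ a, Real.exp (r * (f (Fin.cons a q) - M)) ∂μ 0 ≤
        Real.exp (c ^ 2 * r ^ 2 / 2) * Real.exp (r * (g q - M)) := by
      intro q
      have hne : Nonempty α := (μ 0).nonempty_of_neZero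
      obtain ⟨b⟩ := hne
      -- Hoeffding's lemma on an interval of length 2c around the value at an arbitrary base point;
      -- the resulting variance proxy c² is not optimal but affects only constants.
      have hs := hasSubgaussianMGF_of_mem_Icc (μ := μ 0) (X := fun a => f (Fin.cons a q))
        (a := f (Fin.cons b q) - c) (b := f (Fin.cons b q) + c)
        (measurable_of_finite _).aemeasurable (.of_forall fun a => by
          have h := hf (Fin.cons b q) 0 a
          rw [Fin.update_cons_zero, abs_le] at h
          constructor <;> linarith [h.1, h.2])
      have h := hs.mgf_le r
      rw [mgf] at h
      have e : ∀ a, Real.exp (r * (f (Fin.cons a q) - M)) =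
          Real.exp (r * (g q - M)) * Real.exp (r * (f (Fin.cons a q) - g q)) := fun a => by
        rw [← Real.exp_add]; congr 1; ring
      simp only [e]
      rw [integral_const_mul, mul_comm]
      gcongr
      refine h.trans (le_of_eq ?_)
      congr 2
      push_cast
      rw [Real.norm_eq_abs]
      rw [show f (Fin.cons b q) + c - (f (Fin.cons b q) - c) = 2 * c by ring, abs_mul,
        abs_of_nonneg hc]
      norm_num
    calc _ ≤ ∫ q, Real.exp (c ^ 2 * r ^ 2 / 2) * Real.exp (r * (g q - M)) ∂ν :=
          integral_mono Integrable.of_finite Integrable.of_finite hin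
      _ ≤ Real.exp (c ^ 2 * r ^ 2 / 2) * Real.exp (n * (c ^ 2 * r ^ 2 / 2)) := by
          rw [integral_const_mul]
          gcongr
          exact ih _ g hgd
      _ = _ := by
          rw [← Real.exp_add]
          congr 1
          push_cast
          ring

/-- **McDiarmid's inequality**. -/
theorem measure_ge_le_of_bounded_differences {c : ℝ} (hc : 0 ≤ c) {n : ℕ}
    (μ : Fin n → Measure α) [∀ t, IsProbabilityMeasure (μ t)] (f : (Fin n → α) → ℝ)
    (hf : ∀ p t a, |f (Function.update p t a) - f p| ≤ c) {ε : ℝ} (hε : 0 ≤ ε) :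
    (Measure.pi μ).real {p | ε ≤ f p - ∫ q, f q ∂Measure.pi μ} ≤
      Real.exp (-ε ^ 2 / (2 * (n * c ^ 2))) := by
  have h : HasSubgaussianMGF (fun p => f p - ∫ q, f q ∂Measure.pi μ)
      (⟨n * c ^ 2, by positivity⟩ : NNReal) (Measure.pi μ) :=
    { integrable_exp_mul := fun _ => Integrable.of_finite
      mgf_le := fun r => by
        refine (integral_exp_le_of_bounded_differences hc r μ f hf).trans (le_of_eq ?_)
        congr 1
        change _ = n * c ^ 2 * r ^ 2 / 2
        ring }
  exact h.measure_ge_le hε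

/-- The second moment of a centred sum of independent indicators with vector coefficients. -/
theorem integral_norm_sum_indicator_sub_sq_le [DecidableEq α] {d n : ℕ}
    (μ : Fin n → Measure α) [∀ t, IsProbabilityMeasure (μ t)] (i : α)
    (z : Fin n → EuclideanSpace ℝ (Fin d)) (hz : ∀ t, ‖z t‖ ≤ 1) :
    ∫ p, ‖∑ t, ((if p t = i then (1 : ℝ) else 0) - (μ t).real {i}) • z t‖ ^ 2 ∂Measure.pi μ ≤
      ∑ t, (μ t).real {i} := by
  have hind : ∀ t, ∫ a, (if a = i then (1 : ℝ) else 0) ∂μ t = (μ t).real {i} := fun t => by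
    have := integral_indicator_one (μ := μ t) (measurableSet_singleton i)
    rw [← this]
    refine integral_congr_ae (.of_forall fun a => ?_)
    simp [Set.indicator_apply]
  -- In each coordinate the variances of independent terms add, and each is at most the second
  -- moment of a scaled indicator. Summing over coordinates reassembles the norms of `z t`.
  have hcoord : ∀ j, ∫ p, (∑ t, ((if p t = i then (1 : ℝ) else 0) - (μ t).real {i}) * z t j) ^ 2
      ∂Measure.pi μ ≤ ∑ t, (μ t).real {i} * z t j ^ 2 := by
    intro j
    have hv := variance_sum_pi (μ := μ) (X := fun t a => (if a = i then (1 : ℝ) else 0) * z t j)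
      (fun t => MemLp.of_discrete)
    have hmean : ∫ p, (∑ t, fun p : Fin n → α => (if p t = i then (1 : ℝ) else 0) * z t j) p
        ∂Measure.pi μ = ∑ t, (μ t).real {i} * z t j := by
      simp only [Finset.sum_apply]
      rw [integral_finsetSum _ fun _ _ => Integrable.of_finite]
      refine Finset.sum_congr rfl fun t _ => ?_
      rw [integral_comp_eval (μ := μ) (i := t)
        (f := fun a => (if a = i then (1 : ℝ) else 0) * z t j)
        (measurable_of_finite _).aestronglyMeasurable, integral_mul_const, hind]
    rw [variance_eq_integral (measurable_of_finite _).aemeasurable, hmean] at hv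
    have e : ∀ p : Fin n → α,
        (∑ t, ((if p t = i then (1 : ℝ) else 0) - (μ t).real {i}) * z t j) ^ 2 =
        ((∑ t, fun p : Fin n → α => (if p t = i then (1 : ℝ) else 0) * z t j) p -
          ∑ t, (μ t).real {i} * z t j) ^ 2 := fun p => by
      simp only [Finset.sum_apply, sub_mul, Finset.sum_sub_distrib]
    simp only [e]
    rw [hv]
    refine Finset.sum_le_sum fun t _ => ?_
    refine (variance_le_expectation_sq (measurable_of_finite _).aestronglyMeasurable).trans
      (le_of_eq ?_)
    rw [← hind, ← integral_mul_const]
    refine integral_congr_ae (.of_forall fun a => ?_)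
    simp only [Pi.pow_apply]
    split_ifs <;> simp
  calc _ = ∑ j, ∫ p, (∑ t, ((if p t = i then (1 : ℝ) else 0) - (μ t).real {i}) * z t j) ^ 2
        ∂Measure.pi μ := by
        rw [← integral_finsetSum _ fun _ _ => Integrable.of_finite]
        refine integral_congr_ae (.of_forall fun p => ?_)
        simp only [EuclideanSpace.real_norm_sq_eq, WithLp.ofLp_sum, Finset.sum_apply,
          WithLp.ofLp_smul, Pi.smul_apply, smul_eq_mul]
    _ ≤ ∑ j, ∑ t, (μ t).real {i} * z t j ^ 2 := Finset.sum_le_sum fun j _ => hcoord j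
    _ = ∑ t, (μ t).real {i} * ‖z t‖ ^ 2 := by
        rw [Finset.sum_comm]
        simp only [EuclideanSpace.real_norm_sq_eq, Finset.mul_sum]
    _ ≤ _ := Finset.sum_le_sum fun t _ =>
        mul_le_of_le_one_right measureReal_nonneg (pow_le_one₀ (norm_nonneg _) (hz t))

end Concentration

/-! ### The program -/

theorem lastPos_congr {a b : ℕ → ℝ} {n : ℕ} (h : ∀ i < n, a i = b i) :
    lastPos a n = lastPos b n := by
  induction n with
  | zero => rfl
  | succ n ih => rw [lastPos, lastPos, h n (by omega), ih fun i hi => h i (by omega)]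

theorem mix_congr {N : ℕ} {a b : ℕ → ℝ} (h : ∀ i < N + 1, a i = b i) {i : ℕ} (hi : i < N + 1) :
    mix N a i = mix N b i := by
  have hle := lastPos_le b (N + 1)
  rw [mix, mix, lastPos_congr h]
  split_ifs
  any_goals rfl
  · rw [h i hi, h (i - 1) (by omega)]
  · rw [h i hi, h (i + 1) (by omega)]

/-- The two memories agree on the counters `cs` and on the arrays `as`. -/
def Frame (cs as : List ℕ) (m m' : Memory) : Prop :=
  (∀ v ∈ cs, m'.counter v = m.counter v) ∧ ∀ a ∈ as, m'.cell a = m.cell a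

namespace Frame

variable {cs as : List ℕ} {m m' m'' : Memory}

theorem refl (cs as : List ℕ) (m : Memory) : Frame cs as m m :=
  ⟨fun _ _ => rfl, fun _ _ => rfl⟩

theorem trans (h : Frame cs as m m') (h' : Frame cs as m' m'') : Frame cs as m m'' :=
  ⟨fun v hv => (h'.1 v hv).trans (h.1 v hv), fun a ha => (h'.2 a ha).trans (h.2 a ha)⟩

theorem setCounter (v n : ℕ) (hv : v ∉ cs) (h : Frame cs as m m') :
    Frame cs as m (m'.setCounter v n) := by
  refine h.trans ⟨fun u hu => ?_, fun _ _ => rfl⟩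
  have : u ≠ v := fun e => hv (e ▸ hu)
  simp [Memory.setCounter, this]

theorem run {c : Program} (hc : ∀ v ∈ cs, c.KeepsCounter v) (ha : ∀ a ∈ as, c.KeepsArray a)
    (h : Frame cs as m m') : Frame cs as m (c.run m') :=
  h.trans ⟨fun v hv => Program.counter_run (hc v hv) _, fun a h' => Program.cell_run (ha a h') _⟩

end Frame

theorem loopRun_induction {v n : ℕ} {body : Memory → Memory} {m : Memory}
    (I : ℕ → Memory → Prop) (h0 : I 0 m)
    (hs : ∀ k < n, ∀ m', I k m' → I (k + 1) (body (m'.setCounter v k))) :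
    I n (loopRun v body m n) := by
  induction n with
  | zero => exact h0
  | succ n ih => exact hs n (by omega) _ (ih fun k hk => hs k (by omega))

/-- A loop each of whose passes computes one entry of an array. -/
theorem loopRun_entries {β : Type*} {v n : ℕ} {body : Memory → Memory} {m : Memory}
    (I : Memory → Prop) (entry : Memory → ℕ → β) (f : ℕ → β) (h0 : I m)
    (hs : ∀ k < n, ∀ m', I m' → entry m' k = entry m k →
      I (body (m'.setCounter v k)) ∧ entry (body (m'.setCounter v k)) k = f k ∧
        ∀ i, i ≠ k → entry (body (m'.setCounter v k)) i = entry m' i) :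
    I (loopRun v body m n) ∧ (∀ i < n, entry (loopRun v body m n) i = f i) ∧
      ∀ i, n ≤ i → entry (loopRun v body m n) i = entry m i := by
  -- Entries not yet visited still hold their initial values, which in-place updates rely on.
  refine loopRun_induction (fun n m' => I m' ∧ (∀ i < n, entry m' i = f i) ∧
    ∀ i, n ≤ i → entry m' i = entry m i) ⟨h0, by omega, fun _ _ => rfl⟩ ?_
  rintro k hk m' ⟨h1, h2, h3⟩
  obtain ⟨g1, g2, g3⟩ := hs k hk m' h1 (h3 k le_rfl)
  refine ⟨g1, fun i hi => ?_, fun i hi => ?_⟩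
  · rcases eq_or_ne i k with rfl | hne
    · exact g2
    · rw [g3 i hne]; exact h2 i (by omega)
  · rw [g3 i (by omega)]; exact h3 i (by omega)

/-! ### The text of the program and the correctness of one round. -/

namespace Program

/-- Computes the score of the prediction with index in counter `7`. -/
def scoreEntry : Program :=
  -- Layout throughout: counters 3, 4, 5 hold N, N + 1, t + 1; 6, 7, 8 run over rounds, predictions
  -- and coordinates; 9 holds `lastPos`; 10 serves the grid computation. Arrays 2, 3, 4, 5 hold
  -- probabilities, weights, scores and a squared norm.
  .seq (.setCell 4 (.var 7) (.const 0) (.ofCounter (.const 0)))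
    (.loop 8 (.var 0) (.setCell 4 (.var 7) (.const 0)
      (.add (.cell 4 (.var 7) (.const 0))
        (.mul (.cell 3 (.var 7) (.var 8)) (.cell 0 (.var 6) (.var 8))))))

/-- Computes the scores of all predictions. -/
def scores : Program := .loop 7 (.var 4) scoreEntry

/-- Computes one more than the index of the last positive score. -/
def findLastPos : Program :=
  .seq (.setCounter 9 (.const 0))
    (.loop 7 (.var 4) (.ifLE (.cell 4 (.var 7) (.const 0)) (.ofCounter (.const 0)) .skip
      (.setCounter 9 (.add (.var 7) (.const 1)))))

/-- Stores a probability. -/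
def setProb (e : RealExpr) : Program := .setCell 2 (.var 7) (.const 0) e

/-- Computes the probability of the prediction with index in counter `7`. -/
def mixEntry : Program :=
  .ifLE (.ofCounter (.var 9)) (.ofCounter (.const 0))
    (.ifLE (.ofCounter (.var 7)) (.ofCounter (.const 0))
      (setProb (.ofCounter (.const 1))) (setProb (.ofCounter (.const 0))))
    (.ifLE (.ofCounter (.add (.var 3) (.const 1))) (.ofCounter (.var 9))
      (.ifLE (.ofCounter (.var 3)) (.ofCounter (.var 7))
        (setProb (.ofCounter (.const 1))) (setProb (.ofCounter (.const 0))))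
      (.ifLE (.ofCounter (.var 7)) (.ofCounter (.var 9))
        (.ifLE (.ofCounter (.var 9)) (.ofCounter (.var 7))
          (setProb (.div (.cell 4 (.sub (.var 7) (.const 1)) (.const 0))
            (.sub (.cell 4 (.sub (.var 7) (.const 1)) (.const 0)) (.cell 4 (.var 7) (.const 0)))))
          (.ifLE (.ofCounter (.sub (.var 9) (.const 1))) (.ofCounter (.var 7))
            (setProb (.div (.cell 4 (.add (.var 7) (.const 1)) (.const 0))
              (.sub (.cell 4 (.add (.var 7) (.const 1)) (.const 0))
                (.cell 4 (.var 7) (.const 0)))))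
            (setProb (.ofCounter (.const 0)))))
        (setProb (.ofCounter (.const 0)))))

/-- Computes the distribution of the prediction from the scores. -/
def distribution : Program := .seq findLastPos (.loop 7 (.var 4) mixEntry)

/-- A gradient step for the prediction with index in counter `7`. -/
def gradientStep : Program :=
  .loop 8 (.var 0) (.setCell 3 (.var 7) (.var 8)
    (.add (.cell 3 (.var 7) (.var 8))
      (.mul
        (.div
          (.mul (.cell 2 (.var 7) (.const 0))
            (.sub (.cell 1 (.var 6) (.const 0)) (.div (.ofCounter (.var 7)) (.ofCounter (.var 3)))))
          (.ofCounter (.var 3)))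
        (.cell 0 (.var 6) (.var 8)))))

/-- Computes the squared norm of the weights of the prediction with index in counter `7`. -/
def normSq : Program :=
  .seq (.setCell 5 (.const 0) (.const 0) (.ofCounter (.const 0)))
    (.loop 8 (.var 0) (.setCell 5 (.const 0) (.const 0)
      (.add (.cell 5 (.const 0) (.const 0))
        (.mul (.cell 3 (.var 7) (.var 8)) (.cell 3 (.var 7) (.var 8))))))

/-- Shrinks the weights of the prediction with index in counter `7`. -/
def shrink : Program :=
  .ifLE (.cell 5 (.const 0) (.const 0)) (.ofCounter (.const 1)) .skip
    (.loop 8 (.var 0) (.setCell 3 (.var 7) (.var 8)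
      (.mul
        (.div (.add (.ofCounter (.const 1)) (.cell 5 (.const 0) (.const 0)))
          (.mul (.ofCounter (.const 2)) (.cell 5 (.const 0) (.const 0))))
        (.cell 3 (.var 7) (.var 8)))))

/-- Updates the weights of the prediction with index in counter `7`. -/
def updateEntry : Program := .seq gradientStep (.seq normSq shrink)

/-- One round. -/
def round : Program := .seq scores (.seq distribution (.loop 7 (.var 4) updateEntry))

/-- Computes the number of grid points. -/
def setGrid : Program :=
  .seq (.setCounter 3 (.const 1))
    (.loop 10 (.var 1)
      (.ifLE (.ofCounter (.add (.mul (.var 3) (.mul (.var 3) (.var 3))) (.const 1)))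
        (.ofCounter (.var 1)) (.setCounter 3 (.add (.var 3) (.const 1))) .skip))

/-- The forecasting program. -/
def forecast : Program :=
  -- Rounds 0 to t are replayed. The last pass also updates the weights, reading the missing label
  -- as 0; this is harmless, since only the probabilities it stored beforehand are output.
  .seq (.seq setGrid (.seq (.setCounter 4 (.add (.var 3) (.const 1)))
    (.setCounter 5 (.add (.var 2) (.const 1))))) (.loop 6 (.var 5) round)

theorem run_setCell (a : ℕ) (i j : CounterExpr) (e : RealExpr) (m : Memory) :
    (setCell a i j e).run m = m.setCell a (i.eval m) (j.eval m) (e.eval m) := rfl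

theorem cell_scoreEntry (m : Memory) (i : ℕ) :
    (scoreEntry.run m).cell 4 i 0 = if i = m.counter 7 then
      ∑ j ∈ Finset.range (m.counter 0), m.cell 3 (m.counter 7) j * m.cell 0 (m.counter 6) j
      else m.cell 4 i 0 := by
  rw [scoreEntry, run, run]
  set m₁ := (setCell 4 (.var 7) (.const 0) (.ofCounter (.const 0))).run m with hm₁
  have h := loopRun_induction (v := 8) (n := CounterExpr.eval m₁ (.var 0)) (m := m₁)
    (body := (setCell 4 (.var 7) (.const 0)
      (.add (.cell 4 (.var 7) (.const 0))
        (.mul (.cell 3 (.var 7) (.var 8)) (.cell 0 (.var 6) (.var 8))))).run)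
    (fun n m' => Frame [0, 6, 7] [0, 3] m m' ∧ ∀ i, m'.cell 4 i 0 = if i = m.counter 7 then
      ∑ j ∈ Finset.range n, m.cell 3 (m.counter 7) j * m.cell 0 (m.counter 6) j
      else m.cell 4 i 0) ?_ ?_
  · exact h.2 i
  · refine ⟨(Frame.refl _ _ m).run (by simp [KeepsCounter]) (by simp [KeepsArray]), fun i => ?_⟩
    simp [hm₁, run_setCell, Memory.setCell, CounterExpr.eval, RealExpr.eval]
  · rintro k hk m' ⟨hf, h⟩
    have hf' := hf.setCounter 8 k (by simp)
    refine ⟨hf'.run (by simp [KeepsCounter]) (by simp [KeepsArray]), fun i => ?_⟩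
    have h6 := hf'.1 6 (by simp)
    have h7 := hf'.1 7 (by simp)
    have c0 := hf'.2 0 (by simp)
    have c3 := hf'.2 3 (by simp)
    have h8 : (m'.setCounter 8 k).counter 8 = k := by simp [Memory.setCounter]
    have c4 : (m'.setCounter 8 k).cell 4 = m'.cell 4 := rfl
    simp only [run_setCell, Memory.setCell, CounterExpr.eval, RealExpr.eval, h6, h7, h8, c0, c3,
      c4, true_and, and_true, h, Finset.sum_range_succ, if_true]
    split_ifs <;> rfl

theorem run_scores (m : Memory) :
    Frame [0, 3, 4, 6] [0, 1, 3] m (scores.run m) ∧ ∀ i < m.counter 4,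
      (scores.run m).cell 4 i 0 =
        ∑ j ∈ Finset.range (m.counter 0), m.cell 3 i j * m.cell 0 (m.counter 6) j := by
  have h := loopRun_entries (v := 7) (n := m.counter 4) (body := scoreEntry.run) (m := m)
    (Frame [0, 3, 4, 6] [0, 1, 3] m) (fun m' i => m'.cell 4 i 0)
    (fun i => ∑ j ∈ Finset.range (m.counter 0), m.cell 3 i j * m.cell 0 (m.counter 6) j)
    (Frame.refl _ _ m) ?_
  · exact ⟨h.1, h.2.1⟩
  · intro k hk m' hf he
    have hf' := hf.setCounter 7 k (by simp)
    have h0 := hf'.1 0 (by simp)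
    have h6 := hf'.1 6 (by simp)
    have c0 := hf'.2 0 (by simp)
    have c3 := hf'.2 3 (by simp)
    have h7 : (m'.setCounter 7 k).counter 7 = k := by simp [Memory.setCounter]
    refine ⟨hf'.run (by simp [KeepsCounter, scoreEntry]) (by simp [KeepsArray, scoreEntry]), ?_,
      fun i hi => ?_⟩
    · simp only [cell_scoreEntry, h7, if_true, h0, h6, c0, c3]
    · simp only [cell_scoreEntry, h7, hi, if_false]
      rfl

theorem counter_findLastPos (m : Memory) :
    (findLastPos.run m).counter 9 = lastPos (fun i => m.cell 4 i 0) (m.counter 4) := by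
  rw [findLastPos, run, run]
  set m₁ := (setCounter 9 (.const 0)).run m with hm₁
  have h := loopRun_induction (v := 7) (n := CounterExpr.eval m₁ (.var 4)) (m := m₁)
    (body := (ifLE (.cell 4 (.var 7) (.const 0)) (.ofCounter (.const 0)) .skip
      (.setCounter 9 (.add (.var 7) (.const 1)))).run)
    (fun n m' => m'.cell 4 = m.cell 4 ∧ m'.counter 9 = lastPos (fun i => m.cell 4 i 0) n) ?_ ?_
  · have e : CounterExpr.eval m₁ (.var 4) = m.counter 4 := rfl
    rw [e] at h
    exact h.2
  · simp [hm₁, run, Memory.setCounter, CounterExpr.eval, lastPos]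
  · rintro k hk m' ⟨h4, h⟩
    simp only [run, RealExpr.eval, CounterExpr.eval, Memory.setCounter, Function.update_self, h4,
      Nat.cast_zero, lastPos]
    split_ifs
    · exact ⟨h4, by simpa using h⟩
    · simp [h4]

theorem cell_mixEntry (m : Memory)
    (h9 : m.counter 9 = lastPos (fun i => m.cell 4 i 0) (m.counter 3 + 1))
    (h7 : m.counter 7 < m.counter 3 + 1) (i : ℕ) :
    (mixEntry.run m).cell 2 i 0 = if i = m.counter 7 then
      mix (m.counter 3) (fun i => m.cell 4 i 0) i else m.cell 2 i 0 := by
  have hle := lastPos_le (fun i => m.cell 4 i 0) (m.counter 3 + 1)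
  have hset : ∀ e, ((setProb e).run m).cell 2 i 0 =
      if i = m.counter 7 then e.eval m else m.cell 2 i 0 := fun e => by
    simp [setProb, run_setCell, Memory.setCell, CounterExpr.eval]
  rw [← h9] at hle
  by_cases hi : i = m.counter 7
  · subst hi
    rw [if_pos rfl, mix, ← h9]
    simp only [mixEntry, run, RealExpr.eval, CounterExpr.eval, Nat.cast_le]
    -- The program tests order where `mix` tests equality; `omega` discards the inconsistent
    -- combinations.
    split_ifs <;> first
      | (exfalso; omega)
      | (rw [hset, if_pos rfl]; simp [RealExpr.eval, CounterExpr.eval])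
  · simp only [mixEntry, run]
    split_ifs <;> rw [hset, if_neg hi]

theorem run_distribution (m : Memory) (h4 : m.counter 4 = m.counter 3 + 1) :
    Frame [0, 3, 4, 6] [0, 1, 3] m (distribution.run m) ∧ ∀ i < m.counter 4,
      (distribution.run m).cell 2 i 0 = mix (m.counter 3) (fun i => m.cell 4 i 0) i := by
  rw [distribution, run]
  have hf₁ : Frame [0, 3, 4, 6] [0, 1, 3, 4] m (findLastPos.run m) :=
    (Frame.refl _ _ m).run (by simp [KeepsCounter, findLastPos]) (by simp [KeepsArray, findLastPos])
  have h9 := counter_findLastPos m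
  set m₁ := findLastPos.run m
  have h4₁ : m₁.counter 4 = m.counter 4 := hf₁.1 4 (by simp)
  have h := loopRun_entries (v := 7) (n := m₁.counter 4) (body := mixEntry.run) (m := m₁)
    (fun m' => Frame [0, 3, 4, 6] [0, 1, 3, 4] m m' ∧ m'.counter 9 = m₁.counter 9)
    (fun m' i => m'.cell 2 i 0) (fun i => mix (m.counter 3) (fun i => m.cell 4 i 0) i)
    ⟨hf₁, rfl⟩ ?_
  · exact ⟨⟨h.1.1.1, fun a ha => h.1.1.2 a (by revert ha; simp; tauto)⟩,
      fun i hi => h.2.1 i (by rwa [h4₁])⟩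
  · rintro k hk m' ⟨hf, h9'⟩ -
    have hf' := hf.setCounter 7 k (by simp)
    have h3' := hf'.1 3 (by simp)
    have c4' := hf'.2 4 (by simp)
    have h7 : (m'.setCounter 7 k).counter 7 = k := by simp [Memory.setCounter]
    have h9'' : (m'.setCounter 7 k).counter 9 = m₁.counter 9 := by simpa [Memory.setCounter]
    have key := cell_mixEntry (m'.setCounter 7 k) (by rw [h9'', h9, h3', c4', h4])
      (by rw [h7, h3']; omega)
    simp only [h7, h3', c4'] at key
    refine ⟨⟨hf'.run (by simp [KeepsCounter, mixEntry, setProb])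
      (by simp [KeepsArray, mixEntry, setProb]), ?_⟩, ?_, fun i hi => ?_⟩
    · rw [counter_run (by simp [KeepsCounter, mixEntry, setProb]), h9'']
    · simp only [key, if_true]
    · simp only [key, hi, if_false]
      rfl

/-- The context stored in row `s` of array `0`. -/
noncomputable def contextAt (d : ℕ) (m : Memory) (s : ℕ) : EuclideanSpace ℝ (Fin d) :=
  WithLp.toLp 2 fun j => m.cell 0 s j

theorem run_gradientStep {d : ℕ} (m : Memory) (h0 : m.counter 0 = d) :
    (∀ j : Fin d, (gradientStep.run m).cell 3 (m.counter 7) j = m.cell 3 (m.counter 7) j +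
      m.cell 2 (m.counter 7) 0 *
        (m.cell 1 (m.counter 6) 0 - (m.counter 7 : ℝ) / (m.counter 3 : ℝ)) / (m.counter 3 : ℝ) *
        m.cell 0 (m.counter 6) j) ∧
    ∀ i, i ≠ m.counter 7 → (gradientStep.run m).cell 3 i = m.cell 3 i := by
  have h := loopRun_entries (v := 8) (n := m.counter 0) (m := m)
    (body := (setCell 3 (.var 7) (.var 8)
    (.add (.cell 3 (.var 7) (.var 8))
      (.mul
        (.div
          (.mul (.cell 2 (.var 7) (.const 0))
            (.sub (.cell 1 (.var 6) (.const 0)) (.div (.ofCounter (.var 7)) (.ofCounter (.var 3)))))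
          (.ofCounter (.var 3)))
        (.cell 0 (.var 6) (.var 8))))).run)
    (fun m' => Frame [0, 3, 6, 7] [0, 1, 2] m m' ∧
      ∀ i, i ≠ m.counter 7 → m'.cell 3 i = m.cell 3 i)
    (fun m' j => m'.cell 3 (m.counter 7) j) (fun j => m.cell 3 (m.counter 7) j +
      m.cell 2 (m.counter 7) 0 *
        (m.cell 1 (m.counter 6) 0 - (m.counter 7 : ℝ) / (m.counter 3 : ℝ)) / (m.counter 3 : ℝ) *
        m.cell 0 (m.counter 6) j) ⟨Frame.refl _ _ m, fun _ _ => rfl⟩ ?_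
  · exact ⟨fun j => h.2.1 j (h0 ▸ j.2), h.1.2⟩
  · rintro k hk m' ⟨hf, hr⟩ he
    have hf' := hf.setCounter 8 k (by simp)
    have h3 := hf'.1 3 (by simp)
    have h6 := hf'.1 6 (by simp)
    have h7 := hf'.1 7 (by simp)
    have c0 := hf'.2 0 (by simp)
    have c1 := hf'.2 1 (by simp)
    have c2 := hf'.2 2 (by simp)
    have h8 : (m'.setCounter 8 k).counter 8 = k := by simp [Memory.setCounter]
    have c3 : (m'.setCounter 8 k).cell 3 = m'.cell 3 := rfl
    refine ⟨⟨hf'.run (by simp [KeepsCounter]) (by simp [KeepsArray]), fun i hi => ?_⟩, ?_,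
      fun i hi => ?_⟩
    · funext j
      simp only [run_setCell, Memory.setCell, CounterExpr.eval, h7, hi, false_and, and_false,
        if_false, c3, hr i hi]
    · simp only [run_setCell, Memory.setCell, CounterExpr.eval, RealExpr.eval, h3, h6, h7, h8, c0,
        c1, c2, c3, he, and_self, if_true]
    · simp only [run_setCell, Memory.setCell, CounterExpr.eval, h7, h8, hi, and_false,
        if_false, c3]

theorem cell_normSq (m : Memory) :
    (normSq.run m).cell 5 0 0 =
      ∑ j ∈ Finset.range (m.counter 0), m.cell 3 (m.counter 7) j ^ 2 := by
  rw [normSq, run, run]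
  set m₁ := (setCell 5 (.const 0) (.const 0) (.ofCounter (.const 0))).run m with hm₁
  have h := loopRun_induction (v := 8) (n := CounterExpr.eval m₁ (.var 0)) (m := m₁)
    (body := (setCell 5 (.const 0) (.const 0)
      (.add (.cell 5 (.const 0) (.const 0))
        (.mul (.cell 3 (.var 7) (.var 8)) (.cell 3 (.var 7) (.var 8))))).run)
    (fun n m' => Frame [0, 7] [3] m m' ∧ m'.cell 5 0 0 =
      ∑ j ∈ Finset.range n, m.cell 3 (m.counter 7) j ^ 2) ?_ ?_
  · exact h.2
  · refine ⟨(Frame.refl _ _ m).run (by simp [KeepsCounter]) (by simp [KeepsArray]), ?_⟩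
    simp [hm₁, run_setCell, Memory.setCell, CounterExpr.eval, RealExpr.eval]
  · rintro k hk m' ⟨hf, h⟩
    have hf' := hf.setCounter 8 k (by simp)
    refine ⟨hf'.run (by simp [KeepsCounter]) (by simp [KeepsArray]), ?_⟩
    have h7 := hf'.1 7 (by simp)
    have c3 := hf'.2 3 (by simp)
    have h8 : (m'.setCounter 8 k).counter 8 = k := by simp [Memory.setCounter]
    have c5 : (m'.setCounter 8 k).cell 5 = m'.cell 5 := rfl
    simp only [run_setCell, Memory.setCell, CounterExpr.eval, RealExpr.eval, h7, h8, c3, c5,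
      Finset.sum_range_succ, and_self, if_true, h, sq]

theorem run_shrink {d : ℕ} (m : Memory) (h0 : m.counter 0 = d) :
    (∀ j : Fin d, (shrink.run m).cell 3 (m.counter 7) j =
      if m.cell 5 0 0 ≤ 1 then m.cell 3 (m.counter 7) j
      else (1 + m.cell 5 0 0) / (2 * m.cell 5 0 0) * m.cell 3 (m.counter 7) j) ∧
    ∀ i, i ≠ m.counter 7 → (shrink.run m).cell 3 i = m.cell 3 i := by
  rw [shrink, run]
  simp only [RealExpr.eval, CounterExpr.eval, Nat.cast_one]
  by_cases h1 : m.cell 5 0 0 ≤ 1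
  · simp [h1, run]
  simp only [h1, if_false]
  have h := loopRun_entries (v := 8) (n := m.counter 0) (m := m)
    (body := (setCell 3 (.var 7) (.var 8)
      (.mul
        (.div (.add (.ofCounter (.const 1)) (.cell 5 (.const 0) (.const 0)))
          (.mul (.ofCounter (.const 2)) (.cell 5 (.const 0) (.const 0))))
        (.cell 3 (.var 7) (.var 8)))).run)
    (fun m' => Frame [0, 7] [5] m m' ∧ ∀ i, i ≠ m.counter 7 → m'.cell 3 i = m.cell 3 i)
    (fun m' j => m'.cell 3 (m.counter 7) j)
    (fun j => (1 + m.cell 5 0 0) / (2 * m.cell 5 0 0) * m.cell 3 (m.counter 7) j)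
    ⟨Frame.refl _ _ m, fun _ _ => rfl⟩ ?_
  · exact ⟨fun j => h.2.1 j (h0 ▸ j.2), h.1.2⟩
  · rintro k hk m' ⟨hf, hr⟩ he
    have hf' := hf.setCounter 8 k (by simp)
    have h7 := hf'.1 7 (by simp)
    have c5 := hf'.2 5 (by simp)
    have h8 : (m'.setCounter 8 k).counter 8 = k := by simp [Memory.setCounter]
    have c3 : (m'.setCounter 8 k).cell 3 = m'.cell 3 := rfl
    refine ⟨⟨hf'.run (by simp [KeepsCounter]) (by simp [KeepsArray]), fun i hi => ?_⟩, ?_,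
      fun i hi => ?_⟩
    · funext j
      simp only [run_setCell, Memory.setCell, CounterExpr.eval, h7, hi, false_and, and_false,
        if_false, c3, hr i hi]
    · simp only [run_setCell, Memory.setCell, CounterExpr.eval, RealExpr.eval, h7, h8,
        c3, c5, he, and_self, if_true, Nat.cast_one, Nat.cast_ofNat]
    · simp only [run_setCell, Memory.setCell, CounterExpr.eval, h7, h8, hi, and_false,
        if_false, c3]

theorem run_updateEntry {d : ℕ} (m : Memory) (h0 : m.counter 0 = d) {u : EuclideanSpace ℝ (Fin d)}
    (hu : ∀ j : Fin d, u j = m.cell 3 (m.counter 7) j +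
      m.cell 2 (m.counter 7) 0 *
        (m.cell 1 (m.counter 6) 0 - (m.counter 7 : ℝ) / (m.counter 3 : ℝ)) / (m.counter 3 : ℝ) *
        m.cell 0 (m.counter 6) j) :
    (∀ j : Fin d, (updateEntry.run m).cell 3 (m.counter 7) j = pull u j) ∧
    ∀ i, i ≠ m.counter 7 → (updateEntry.run m).cell 3 i = m.cell 3 i := by
  obtain ⟨g1, g2⟩ := run_gradientStep m h0
  rw [updateEntry, run, run]
  have hf₁ : Frame [0, 7] [] m (gradientStep.run m) :=
    (Frame.refl _ _ m).run (by simp [KeepsCounter, gradientStep]) (by simp)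
  set m₁ := gradientStep.run m
  have hn := cell_normSq m₁
  have hf₂ : Frame [0, 7] [3] m₁ (normSq.run m₁) :=
    (Frame.refl _ _ m₁).run (by simp [KeepsCounter, normSq]) (by simp [KeepsArray, normSq])
  set m₂ := normSq.run m₁
  have h7₁ := hf₁.1 7 (by simp)
  have h7 : m₂.counter 7 = m.counter 7 := (hf₂.1 7 (by simp)).trans h7₁
  have h0₁ : m₁.counter 0 = d := (hf₁.1 0 (by simp)).trans h0
  have h0₂ : m₂.counter 0 = d := (hf₂.1 0 (by simp)).trans h0₁
  have c3 : m₂.cell 3 = m₁.cell 3 := hf₂.2 3 (by simp)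
  obtain ⟨s1, s2⟩ := run_shrink m₂ h0₂
  have hw : ∀ j : Fin d, m₁.cell 3 (m.counter 7) j = u j := fun j => by rw [g1, hu]
  rw [h7₁, h0₁, Finset.sum_range] at hn
  simp only [hw] at hn
  rw [← EuclideanSpace.real_norm_sq_eq] at hn
  rw [h7, c3, hn] at s1
  rw [h7, c3] at s2
  refine ⟨fun j => ?_, fun i hi => (s2 i hi).trans (g2 i hi)⟩
  rw [s1, hw, pull]
  split_ifs <;> rfl

theorem run_round {d N s : ℕ} (m : Memory) (h0 : m.counter 0 = d) (h3 : m.counter 3 = N)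
    (h4 : m.counter 4 = N + 1) (h6 : m.counter 6 = s) {w : ℕ → EuclideanSpace ℝ (Fin d)}
    (hw : ∀ i < N + 1, ∀ j : Fin d, m.cell 3 i j = w i j) :
    (∀ i < N + 1, (round.run m).cell 2 i 0 =
      mix N (fun k => inner ℝ (w k) (contextAt d m s)) i) ∧
    ∀ i < N + 1, ∀ j : Fin d, (round.run m).cell 3 i j =
      nextWeights N w (contextAt d m s) (m.cell 1 s 0) i j := by
  obtain ⟨hf₁, hs⟩ := run_scores m
  rw [round, run, run, run]
  set m₁ := scores.run m
  have h3₁ : m₁.counter 3 = N := (hf₁.1 3 (by simp)).trans h3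
  have h4₁ : m₁.counter 4 = N + 1 := (hf₁.1 4 (by simp)).trans h4
  obtain ⟨hf₂, hd⟩ := run_distribution m₁ (by rw [h3₁, h4₁])
  have hf := hf₁.trans hf₂
  set m₂ := distribution.run m₁
  have hscore : ∀ i < N + 1, m₁.cell 4 i 0 = inner ℝ (w i) (contextAt d m s) := by
    intro i hi
    rw [hs i (by omega), h0, h6, Finset.sum_range, PiLp.inner_apply]
    refine Finset.sum_congr rfl fun j _ => ?_
    rw [hw i hi]
    simp [contextAt, mul_comm]
  have hprob : ∀ i < N + 1, m₂.cell 2 i 0 =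
      mix N (fun k => inner ℝ (w k) (contextAt d m s)) i := by
    intro i hi
    rw [hd i (by omega), h3₁]
    exact mix_congr hscore hi
  have e4 : CounterExpr.eval m₂ (.var 4) = N + 1 := (hf.1 4 (by simp)).trans h4
  rw [e4]
  have h := loopRun_entries (v := 7) (n := N + 1) (body := updateEntry.run) (m := m₂)
    (fun m' => Frame [0, 3, 4, 6] [0, 1, 2] m₂ m')
    (fun m' i => fun j : Fin d => m'.cell 3 i j)
    (fun i => fun j : Fin d => nextWeights N w (contextAt d m s) (m.cell 1 s 0) i j)
    (Frame.refl _ _ m₂) ?_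
  · exact ⟨fun i hi => by rw [h.1.2 2 (by simp), hprob i hi],
      fun i hi j => congrFun (h.2.1 i hi) j⟩
  · intro k hk m' hf' he
    have hf'' := hf'.setCounter 7 k (by simp)
    have h7 : (m'.setCounter 7 k).counter 7 = k := by simp [Memory.setCounter]
    have g0 := ((hf''.1 0 (by simp)).trans (hf.1 0 (by simp))).trans h0
    have g3 := ((hf''.1 3 (by simp)).trans (hf.1 3 (by simp))).trans h3
    have g6 := ((hf''.1 6 (by simp)).trans (hf.1 6 (by simp))).trans h6
    have c0 := (hf''.2 0 (by simp)).trans (hf.2 0 (by simp))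
    have c1 := (hf''.2 1 (by simp)).trans (hf.2 1 (by simp))
    have c2 := hf''.2 2 (by simp)
    have c3 : ∀ j : Fin d, (m'.setCounter 7 k).cell 3 k j = w k j := fun j => by
      have := congrFun he j
      rw [← hw k hk, ← hf.2 3 (by simp), ← this]
      rfl
    obtain ⟨u1, u2⟩ := run_updateEntry (m'.setCounter 7 k) g0
      (u := w k + (mix N (fun j => inner ℝ (w j) (contextAt d m s)) k *
        (m.cell 1 s 0 - k / N) / N) • contextAt d m s) (fun j => by
          simp only [h7, g3, g6, c0, c1, c2, c3, hprob k hk]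
          simp [contextAt])
    rw [h7] at u1 u2
    refine ⟨hf''.run ?_ ?_, ?_, fun i hi => ?_⟩
    · simp [KeepsCounter, updateEntry, gradientStep, normSq, shrink]
    · simp [KeepsArray, updateEntry, gradientStep, normSq, shrink]
    · funext j
      exact u1 j
    · simp only [u2 i hi]
      rfl

end Program

/-! ### The forecaster -/

/-- Increases `1` at most `k` times, as long as the cube is less than `T`. -/
def growGrid (T : ℕ) : ℕ → ℕ
  | 0 => 1
  | k + 1 =>
    if growGrid T k * (growGrid T k * growGrid T k) + 1 ≤ T then growGrid T k + 1
    else growGrid T k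

/-- The least positive integer whose cube is at least `T`. -/
def gridSize (T : ℕ) : ℕ := growGrid T T

/-- Either the cube has reached `T` or every step so far was an increase; after `T` steps both give
a cube of at least `T`. The last conjunct bounds the grid from above. -/
theorem growGrid_spec (T k : ℕ) : 0 < growGrid T k ∧ growGrid T k ≤ k + 1 ∧
    (T ≤ growGrid T k ^ 3 ∨ growGrid T k = k + 1) ∧ (growGrid T k - 1) ^ 3 ≤ T := by
  induction k with
  | zero => simp [growGrid]
  | succ k ih =>
    obtain ⟨h1, h2, h3, h4⟩ := ih
    have e : growGrid T k * (growGrid T k * growGrid T k) = growGrid T k ^ 3 := by ring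
    rw [growGrid, e]
    split_ifs with h
    · refine ⟨by omega, by omega, .inr (by omega), ?_⟩
      rw [Nat.add_sub_cancel]
      omega
    · exact ⟨h1, by omega, .inl (by omega), h4⟩

theorem gridSize_pos (T : ℕ) : 0 < gridSize T := (growGrid_spec T T).1

theorem gridSize_le (T : ℕ) : gridSize T ≤ T + 1 := (growGrid_spec T T).2.1

theorem le_gridSize_pow (T : ℕ) : T ≤ gridSize T ^ 3 := by
  rcases (growGrid_spec T T).2.2.1 with h | h
  · exact h
  · rw [gridSize, h]
    exact (Nat.le_succ T).trans (Nat.le_self_pow (by norm_num) _)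

theorem gridSize_sub_one_pow_le (T : ℕ) : (gridSize T - 1) ^ 3 ≤ T := (growGrid_spec T T).2.2.2

section Sequences

variable {d n : ℕ} [NeZero d]

/-- The contexts as an infinite sequence. -/
noncomputable def contextSeq (x : Fin n → Context d) (s : ℕ) : EuclideanSpace ℝ (Fin d) :=
  if h : s < n then x ⟨s, h⟩ else 0

/-- The labels as an infinite sequence. -/
noncomputable def labelSeq (y : Fin n → Label) (s : ℕ) : ℝ :=
  if h : s < n then y ⟨s, h⟩ else 0

theorem norm_contextSeq_le (x : Fin n → Context d) (s : ℕ) : ‖contextSeq x s‖ ≤ 1 := by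
  rw [contextSeq]
  split_ifs
  · exact (x _).2.1
  · simp

theorem label_mem_Icc (y : Label) : (0 : ℝ) ≤ y ∧ (y : ℝ) ≤ 1 := by
  rcases y.2 with h | h <;> rw [h] <;> norm_num

theorem labelSeq_mem_Icc (y : Fin n → Label) (s : ℕ) : 0 ≤ labelSeq y s ∧ labelSeq y s ≤ 1 := by
  rw [labelSeq]
  split_ifs
  · exact label_mem_Icc _
  · norm_num

end Sequences

/-- Swap multicalibration by projected gradient ascent. -/
noncomputable def gradientForecaster (d T : ℕ) [NeZero d] : Forecaster d where
  N := gridSize T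
  N_pos := gridSize_pos T
  predict t x y := PMF.ofFintype
    (fun i => ENNReal.ofReal (prob (gridSize T) (contextSeq x) (labelSeq y) t i)) (by
      rw [← ENNReal.ofReal_sum_of_nonneg fun i _ => prob_nonneg _ _ _ _ _,
        ← Finset.sum_range fun i => prob (gridSize T) (contextSeq x) (labelSeq y) t i]
      exact (congrArg ENNReal.ofReal (sum_mix _ _)).trans ENNReal.ofReal_one)

theorem toReal_predict (d T : ℕ) [NeZero d] (t : ℕ) (x : Fin (t + 1) → Context d)
    (y : Fin t → Label) (i : Fin (gridSize T + 1)) :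
    ((gradientForecaster d T).predict t x y i).toReal =
      prob (gridSize T) (contextSeq x) (labelSeq y) t i :=
  ENNReal.toReal_ofReal (prob_nonneg _ _ _ _ _)

/-- The forecaster pads what it has seen by zeros. Since `prob` ignores the future, the padded
prefix may be replaced by the full sequence. -/
theorem toReal_dist (d T : ℕ) [NeZero d] (x : Fin T → Context d) (y : Fin T → Label)
    (t : Fin T) (i : Fin (gridSize T + 1)) :
    ((gradientForecaster d T).dist x y t i).toReal =
      prob (gridSize T) (contextSeq x) (labelSeq y) t i := by
  rw [Forecaster.dist, toReal_predict]
  refine congrFun (prob_congr _ (fun s hs => ?_) fun s hs => ?_) _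
  · have h : s < T := by omega
    simp [contextSeq, h, Nat.lt_succ_of_le hs]
  · have h : s < T := by omega
    simp [labelSeq, h, hs]

/-! ### Correctness and running time of the whole program. -/

namespace Program

theorem counter_setGrid (m : Memory) : (setGrid.run m).counter 3 = gridSize (m.counter 1) := by
  rw [setGrid, run, run]
  set m₁ := (setCounter 3 (.const 1)).run m with hm₁
  have h := loopRun_induction (v := 10) (n := CounterExpr.eval m₁ (.var 1)) (m := m₁)
    (body := (ifLE (.ofCounter (.add (.mul (.var 3) (.mul (.var 3) (.var 3))) (.const 1)))
        (.ofCounter (.var 1)) (.setCounter 3 (.add (.var 3) (.const 1))) .skip).run)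
    (fun n m' => m'.counter 1 = m.counter 1 ∧ m'.counter 3 = growGrid (m.counter 1) n) ?_ ?_
  · have e : CounterExpr.eval m₁ (.var 1) = m.counter 1 := rfl
    rw [e] at h
    exact h.2
  · simp [hm₁, run, Memory.setCounter, CounterExpr.eval, growGrid]
  · rintro k hk m' ⟨h1, h3⟩
    have h1' : (m'.setCounter 10 k).counter 1 = m.counter 1 := h1
    have h3' : (m'.setCounter 10 k).counter 3 = growGrid (m.counter 1) k := h3
    simp only [run, RealExpr.eval, CounterExpr.eval, h1', h3', Nat.cast_le, growGrid]
    split_ifs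
    · simp [Memory.setCounter, h1]
    · exact ⟨h1, h3⟩

theorem run_forecast {d T t : ℕ} [NeZero d] (x : Fin (t + 1) → Context d)
    (y : Fin t → Label) :
    (forecast.run (input T t x y)).counter 3 = gridSize T ∧ ∀ i < gridSize T + 1,
      (forecast.run (input T t x y)).cell 2 i 0 =
        prob (gridSize T) (contextSeq x) (labelSeq y) t i := by
  set m := input T t x y with hm
  set N := gridSize T with hN
  rw [forecast, run, run, run, run]
  have hg : (setGrid.run m).counter 3 = N := counter_setGrid m
  have hf₀ : Frame [0, 2] [0, 1, 3] m (setGrid.run m) :=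
    (Frame.refl _ _ m).run (by simp [KeepsCounter, setGrid]) (by simp [KeepsArray, setGrid])
  set m₀ := setGrid.run m
  set m₁ := (setCounter 5 (.add (.var 2) (.const 1))).run
    ((setCounter 4 (.add (.var 3) (.const 1))).run m₀) with hm₁
  have hf₁ : Frame [0, 2] [0, 1, 3] m m₁ :=
    (hf₀.run (by simp [KeepsCounter]) (by simp [KeepsArray])).run (by simp [KeepsCounter])
      (by simp [KeepsArray])
  have h3 : m₁.counter 3 = N := hg
  have h4 : m₁.counter 4 = N + 1 := congrArg (· + 1) hg
  have h5 : CounterExpr.eval m₁ (.var 5) = t + 1 := congrArg (· + 1) (hf₀.1 2 (by simp))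
  have h0 : m₁.counter 0 = d := hf₁.1 0 (by simp)
  change (loopRun 6 round.run m₁ (CounterExpr.eval m₁ (.var 5))).counter 3 = N ∧
    ∀ i < N + 1, (loopRun 6 round.run m₁ (CounterExpr.eval m₁ (.var 5))).cell 2 i 0 =
      prob N (contextSeq x) (labelSeq y) t i
  rw [h5]
  have hX : ∀ s, contextAt d m₁ s = contextSeq x s := by
    intro s
    ext j
    rw [contextAt, hf₁.2 0 (by simp)]
    by_cases h : s ≤ t <;> simp [hm, input, contextSeq, h]
  have hY : ∀ s, m₁.cell 1 s 0 = labelSeq y s := by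
    intro s
    rw [hf₁.2 1 (by simp)]
    by_cases h : s < t <;> simp [hm, input, labelSeq, h]
  -- After `k` passes the weights are those entering round `k`, while the probabilities are those of
  -- round `k - 1`; nothing is claimed about them before the first pass.
  have h := loopRun_induction (v := 6) (n := t + 1) (m := m₁) (body := round.run)
    (fun k m' => Frame [0, 3, 4] [0, 1] m₁ m' ∧
      (∀ i < N + 1, ∀ j : Fin d, m'.cell 3 i j = weights N (contextSeq x) (labelSeq y) k i j) ∧
      ∀ s, k = s + 1 → ∀ i < N + 1, m'.cell 2 i 0 = prob N (contextSeq x) (labelSeq y) s i) ?_ ?_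
  · exact ⟨(h.1.1 3 (by simp)).trans h3, h.2.2 t rfl⟩
  · refine ⟨Frame.refl _ _ _, fun i _ j => ?_, fun s hs => by omega⟩
    rw [hf₁.2 3 (by simp)]
    simp [hm, input, weights]
  · rintro k hk m' ⟨hf, hw, -⟩
    have hf' := hf.setCounter 6 k (by simp)
    have c0 : contextAt d (m'.setCounter 6 k) k = contextSeq x k := by
      rw [← hX, contextAt, contextAt, hf'.2 0 (by simp)]
    have c1 : (m'.setCounter 6 k).cell 1 k 0 = labelSeq y k := by rw [← hY, hf'.2 1 (by simp)]
    obtain ⟨r1, r2⟩ := run_round (m'.setCounter 6 k) ((hf'.1 0 (by simp)).trans h0)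
      ((hf'.1 3 (by simp)).trans h3) ((hf'.1 4 (by simp)).trans h4)
      (s := k) (by simp [Memory.setCounter]) (w := weights N (contextSeq x) (labelSeq y) k) hw
    rw [c0] at r1
    rw [c0, c1] at r2
    refine ⟨hf'.run ?_ ?_, r2, fun s hs => ?_⟩
    · simp [KeepsCounter, round, scores, scoreEntry, distribution, findLastPos, mixEntry, setProb,
        updateEntry, gradientStep, normSq, shrink]
    · simp [KeepsArray, round, scores, scoreEntry, distribution, findLastPos, mixEntry, setProb,
        updateEntry, gradientStep, normSq, shrink]
    · obtain rfl : k = s := by omega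
      exact r1

theorem steps_forecast_le {d T t : ℕ} [NeZero d] (ht : t < T) (x : Fin (t + 1) → Context d)
    (y : Fin t → Label) :
    forecast.steps (input T t x y) ≤ forecast.stepBound (2 * (d + T)) := by
  have hd : 0 < d := Nat.pos_of_neZero d
  rw [forecast, steps, stepBound]
  -- The loop bounds in counters 4 and 5 are written during setup, so the setup and the main loop
  -- are bounded separately.
  refine add_le_add ?_ ?_
  · refine steps_le_stepBound (S := [1]) (by simp [LoopsOver, setGrid])
      (by simp [KeepsCounter, setGrid]) _ ?_
    simp only [List.mem_singleton, forall_eq]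
    change T ≤ _
    omega
  · refine steps_le_stepBound (S := [0, 4, 5])
      (by simp [LoopsOver, round, scores, scoreEntry, distribution, findLastPos, mixEntry, setProb,
        updateEntry, gradientStep, normSq, shrink])
      (by simp [KeepsCounter, round, scores, scoreEntry, distribution, findLastPos, mixEntry,
        setProb, updateEntry, gradientStep, normSq, shrink]) _ ?_
    have hg := counter_setGrid (input T t x y)
    have hf : Frame [0, 2] [] (input T t x y) (setGrid.run (input T t x y)) :=
      (Frame.refl _ _ _).run (by simp [KeepsCounter, setGrid]) (by simp)
    have hle := gridSize_le T
    simp only [List.mem_cons, List.not_mem_nil, or_false, forall_eq_or_imp, forall_eq]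
    refine ⟨?_, ?_, ?_⟩
    · change (setGrid.run (input T t x y)).counter 0 ≤ _
      rw [hf.1 0 (by simp)]
      change d ≤ _
      omega
    · change (setGrid.run (input T t x y)).counter 3 + 1 ≤ _
      rw [hg]
      change gridSize T + 1 ≤ _
      omega
    · change (setGrid.run (input T t x y)).counter 2 + 1 ≤ _
      rw [hf.1 2 (by simp)]
      change t + 1 ≤ _
      omega

end Program

theorem efficient_gradientForecaster : Efficient fun d T => gradientForecaster d T := by
  obtain ⟨K, k, h⟩ := Program.exists_stepBound_le Program.forecast
  refine ⟨Program.forecast, K * 2 ^ k, k, fun d T _ t ht x y => ?_⟩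
  obtain ⟨h1, h2⟩ := Program.run_forecast (T := T) x y
  refine ⟨h1, fun i => ?_, ?_⟩
  · exact (h2 i i.2).trans (toReal_predict d T t x y i).symm
  · refine (Program.steps_forecast_le ht x y).trans ((h _ (by omega)).trans (le_of_eq ?_))
    rw [mul_pow]
    ring

/-! ### The error of the forecaster -/

/-- A linear function that is bounded by `1` on the contexts has a parameter of norm at most `2`. -/
theorem norm_le_two_of_abs_inner_le {d : ℕ} [NeZero d] {θ : EuclideanSpace ℝ (Fin d)}
    (h : ∀ x : Context d, |inner ℝ θ (x : EuclideanSpace ℝ (Fin d))| ≤ 1) : ‖θ‖ ≤ 2 := by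
  set e : EuclideanSpace ℝ (Fin d) := EuclideanSpace.single 0 1 with he
  have hee : inner ℝ e e = (1 : ℝ) := by simp [he]
  set v := θ - θ 0 • e with hv
  have hv0 : v 0 = 0 := by simp [hv, he]
  have hev : inner ℝ e v = 0 := by simp [he, EuclideanSpace.inner_single_left, hv0]
  have hθ : θ = θ 0 • e + v := by rw [hv]; abel
  set u := ‖v‖⁻¹ • v with hu
  have hu0 : u 0 = 0 := by simp [hu, hv0]
  have heu : inner ℝ e u = 0 := by rw [hu, real_inner_smul_right, hev, mul_zero]
  have hun : ‖u‖ ≤ 1 := by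
    rw [hu, norm_smul, norm_inv, norm_norm]
    exact inv_mul_le_one
  have hθu : inner ℝ θ u = ‖v‖ := by
    rw [hθ, inner_add_left, real_inner_smul_left, heu, hu, real_inner_smul_right,
      real_inner_self_eq_norm_sq]
    rcases eq_or_ne ‖v‖ 0 with h0 | h0
    · simp [h0]
    · field_simp
      ring
  have hθe : inner ℝ θ e = θ 0 := by simp [he, EuclideanSpace.inner_single_right]
  -- The contexts (e ± u)/2 give |θ 0| + ‖v‖ ≤ 2. If `v = 0`, as for d = 1, then `u = 0` by the
  -- convention for inverses.
  have key : ∀ s : ℝ, s ^ 2 ≤ 1 → |θ 0 / 2 + s * ‖v‖ / 2| ≤ 1 := by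
    intro s hs
    have hx : ((1 / 2 : ℝ) • e + (s / 2) • u) ∈ Context d := by
      refine ⟨?_, by simp [he, hu0]⟩
      have hsq : ‖(1 / 2 : ℝ) • e + (s / 2) • u‖ ^ 2 ≤ 1 := by
        rw [norm_add_sq_real, real_inner_smul_left, real_inner_smul_right, heu, norm_smul,
          norm_smul, mul_pow, mul_pow, ← real_inner_self_eq_norm_sq e, hee, Real.norm_eq_abs,
          Real.norm_eq_abs, sq_abs, sq_abs]
        have hu2 : ‖u‖ ^ 2 ≤ 1 := pow_le_one₀ (norm_nonneg _) hun
        nlinarith [mul_le_mul hs hu2 (sq_nonneg _) zero_le_one]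
      exact (sq_le_one_iff₀ (norm_nonneg _)).1 hsq
    have := h ⟨_, hx⟩
    simp only [inner_add_right, real_inner_smul_right, hθu, hθe] at this
    convert this using 2
    ring
  have h1 := abs_le.1 (key 1 (by norm_num))
  have h2 := abs_le.1 (key (-1) (by norm_num))
  have hn : ‖θ‖ ^ 2 = θ 0 ^ 2 + ‖v‖ ^ 2 := by
    conv_lhs => rw [hθ]
    rw [norm_add_sq_real, real_inner_smul_left, hev, norm_smul, mul_pow,
      ← real_inner_self_eq_norm_sq e, hee, Real.norm_eq_abs, sq_abs]
    ring
  have hv' := norm_nonneg v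
  have : ‖θ‖ ^ 2 ≤ 2 ^ 2 := by
    rw [hn]
    rcases abs_cases (θ 0) with ⟨-, h0⟩ | ⟨-, h0⟩ <;> nlinarith
  exact (sq_le_sq₀ (norm_nonneg _) zero_le_two).1 this

section Error

variable {d N T : ℕ}

/-- The sum over the predictions of the norms of the accumulated residual vectors. -/
noncomputable def residual (x : Fin T → EuclideanSpace ℝ (Fin d)) (y : Fin T → Label)
    (p : Fin T → Fin (N + 1)) : ℝ :=
  ∑ i : Fin (N + 1), ‖∑ t, (if p t = i then (1 : ℝ) else 0) • ((y t : ℝ) - grid i) • x t‖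

/-- The count cancels the denominator of the average, and Cauchy–Schwarz with ‖θ‖ ≤ 2 bounds every
comparator at once. -/
theorem swapMulticalError_le [NeZero d] (x : Fin T → Context d) (y : Fin T → Label)
    (p : Fin T → Fin (N + 1)) :
    swapMulticalError (bounded (linClass d) 1) 1 x y p ≤
      2 * residual (fun t => (x t : EuclideanSpace ℝ (Fin d))) y p := by
  have h0 : (fun _ => 0) ∈ bounded (linClass d) 1 := ⟨⟨0, by simp⟩, by simp⟩
  have : Nonempty (Fin (N + 1) → bounded (linClass d) 1) := ⟨fun _ => ⟨_, h0⟩⟩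
  refine ciSup_le fun f => ?_
  rw [residual, Finset.mul_sum]
  refine Finset.sum_le_sum fun i _ => ?_
  obtain ⟨⟨θ, hθ⟩, hb⟩ := (f i).2
  have hn : ‖θ‖ ≤ 2 := norm_le_two_of_abs_inner_le fun z => by
    rw [← hθ]
    exact abs_le_one_iff_mul_self_le_one.2 (by simpa [sq] using hb z)
  have hc : 0 ≤ count p i := Finset.sum_nonneg fun t _ => by split_ifs <;> norm_num
  have hS : ∑ t, (if p t = i then (1 : ℝ) else 0) * (f i : Context d → ℝ) (x t) *
      ((y t : ℝ) - grid i) = inner ℝ θ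
        (∑ t, (if p t = i then (1 : ℝ) else 0) • ((y t : ℝ) - grid i) •
          (x t : EuclideanSpace ℝ (Fin d))) := by
    rw [inner_sum]
    refine Finset.sum_congr rfl fun t _ => ?_
    rw [hθ, real_inner_smul_right, real_inner_smul_right]
    ring
  rw [pow_one, corr, abs_div, abs_of_nonneg hc, hS]
  have hmul : ∀ a : ℝ, 0 ≤ a → count p i * (a / count p i) ≤ a := fun a ha => by
    rcases hc.eq_or_lt with h | h
    · simpa [← h] using ha
    · rw [mul_div_cancel₀ _ h.ne']
  refine (hmul _ (abs_nonneg _)).trans ((abs_real_inner_le_norm _ _).trans ?_)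
  gcongr

theorem grid_eq (i : Fin (N + 1)) : grid i = ((i : ℕ) : ℝ) / N := rfl

theorem norm_residual_term_le {x : EuclideanSpace ℝ (Fin d)} (hx : ‖x‖ ≤ 1) (y : Label)
    (i : Fin (N + 1)) : ‖((y : ℝ) - grid i) • x‖ ≤ 1 := by
  rw [norm_smul, Real.norm_eq_abs]
  obtain ⟨h0, h1⟩ := label_mem_Icc y
  exact mul_le_one₀ (abs_label_sub_le h0 h1 i.2) (norm_nonneg _) hx

theorem residual_le {x : Fin T → EuclideanSpace ℝ (Fin d)} (hx : ∀ t, ‖x t‖ ≤ 1)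
    (y : Fin T → Label) (p : Fin T → Fin (N + 1)) : residual x y p ≤ T := by
  calc residual x y p ≤ ∑ i : Fin (N + 1), ∑ t, (if p t = i then (1 : ℝ) else 0) := by
        refine Finset.sum_le_sum fun i _ => (norm_sum_le _ _).trans
          (Finset.sum_le_sum fun t _ => ?_)
        have := norm_residual_term_le (hx t) (y t) i
        split_ifs <;> simp [this]
    _ = T := by
        rw [Finset.sum_comm]
        simp

/-- One vector of norm at most 1 leaves one sum and another enters a possibly different sum. -/
theorem abs_residual_update_sub_le {x : Fin T → EuclideanSpace ℝ (Fin d)} (hx : ∀ t, ‖x t‖ ≤ 1)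
    (y : Fin T → Label) (p : Fin T → Fin (N + 1)) (t : Fin T) (a : Fin (N + 1)) :
    |residual x y (Function.update p t a) - residual x y p| ≤ 2 := by
  rw [residual, residual, ← Finset.sum_sub_distrib]
  calc _ ≤ ∑ i : Fin (N + 1), ((if a = i then (1 : ℝ) else 0) + if p t = i then 1 else 0) := by
        refine (Finset.abs_sum_le_sum_abs _ _).trans (Finset.sum_le_sum fun i _ => ?_)
        refine (abs_norm_sub_norm_le _ _).trans ?_
        rw [← Finset.sum_sub_distrib, Finset.sum_eq_single t]
        · rw [Function.update_self, ← sub_smul, norm_smul]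
          refine (mul_le_of_le_one_right (norm_nonneg _)
            (norm_residual_term_le (hx t) (y t) i)).trans ?_
          split_ifs <;> norm_num
        · intro s _ hs
          rw [Function.update_of_ne hs, sub_self]
        · simp
    _ = 2 := by
        rw [Finset.sum_add_distrib]
        simp
        norm_num

/-- Each sum is its mean plus centred noise Z, and ‖Z‖ ≤ N/2 + ‖Z‖²/(2N) by AM–GM. The second
moments are then added linearly over the grid, where the probabilities total T. -/
theorem integral_residual_le (hN : 0 < N) {x : Fin T → EuclideanSpace ℝ (Fin d)}
    (hx : ∀ t, ‖x t‖ ≤ 1) (y : Fin T → Label) (μ : Fin T → Measure (Fin (N + 1)))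
    [∀ t, IsProbabilityMeasure (μ t)] :
    ∫ p, residual x y p ∂Measure.pi μ ≤
      ∑ i : Fin (N + 1), ‖∑ t, ((μ t).real {i} * ((y t : ℝ) - grid i)) • x t‖ +
        ((N + 1) * N + T / N) / 2 := by
  have hN' : (0 : ℝ) < N := by exact_mod_cast hN
  have hterm : ∀ i : Fin (N + 1),
      ∫ p, ‖∑ t, (if p t = i then (1 : ℝ) else 0) • ((y t : ℝ) - grid i) • x t‖ ∂Measure.pi μ ≤
        ‖∑ t, ((μ t).real {i} * ((y t : ℝ) - grid i)) • x t‖ +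
          (N / 2 + (∑ t, (μ t).real {i}) / (2 * N)) := by
    intro i
    set Z : (Fin T → Fin (N + 1)) → EuclideanSpace ℝ (Fin d) := fun p =>
      ∑ t, ((if p t = i then (1 : ℝ) else 0) - (μ t).real {i}) • ((y t : ℝ) - grid i) • x t
    have h2 : ∫ p, ‖Z p‖ ^ 2 ∂Measure.pi μ ≤ ∑ t, (μ t).real {i} :=
      integral_norm_sum_indicator_sub_sq_le μ i _ fun t => norm_residual_term_le (hx t) (y t) i
    calc _ ≤ ∫ p, (‖∑ t, ((μ t).real {i} * ((y t : ℝ) - grid i)) • x t‖ +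
          (N / 2 + ‖Z p‖ ^ 2 / (2 * N))) ∂Measure.pi μ := by
          refine integral_mono Integrable.of_finite Integrable.of_finite fun p => ?_
          have e : ∑ t, (if p t = i then (1 : ℝ) else 0) • ((y t : ℝ) - grid i) • x t =
              ∑ t, ((μ t).real {i} * ((y t : ℝ) - grid i)) • x t + Z p := by
            rw [← Finset.sum_add_distrib]
            refine Finset.sum_congr rfl fun t _ => ?_
            rw [mul_smul, ← add_smul, add_sub_cancel]
          simp only
          rw [e]
          refine (norm_add_le _ _).trans ?_
          gcongr
          rw [← sub_nonneg]
          have : (N : ℝ) / 2 + ‖Z p‖ ^ 2 / (2 * N) - ‖Z p‖ = (‖Z p‖ - N) ^ 2 / (2 * N) := by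
            field_simp
            ring
          rw [this]
          positivity
      _ = ‖∑ t, ((μ t).real {i} * ((y t : ℝ) - grid i)) • x t‖ +
          (N / 2 + (∫ p, ‖Z p‖ ^ 2 ∂Measure.pi μ) / (2 * N)) := by
          rw [integral_add Integrable.of_finite Integrable.of_finite,
            integral_add Integrable.of_finite Integrable.of_finite]
          simp only [integral_div]
          simp
      _ ≤ _ := by gcongr
  have hone : ∀ t, ∑ i, (μ t).real {i} = 1 := fun t => by
    rw [sum_measureReal_singleton]
    simp
  calc _ = ∑ i : Fin (N + 1), ∫ p,
        ‖∑ t, (if p t = i then (1 : ℝ) else 0) • ((y t : ℝ) - grid i) • x t‖ ∂Measure.pi μ :=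
        integral_finsetSum _ fun _ _ => Integrable.of_finite
    _ ≤ _ := Finset.sum_le_sum fun i _ => hterm i
    _ = _ := by
        rw [Finset.sum_add_distrib, Finset.sum_add_distrib]
        simp only [← Finset.sum_div]
        rw [Finset.sum_comm]
        simp only [hone]
        simp
        field_simp

end Error

theorem le_rate_of_lt {d T : ℕ} (hT : 2 ≤ T) (h : (T : ℝ) < (d : ℝ) * Real.log T) :
    (T : ℝ) ≤ (T : ℝ) ^ (2 / 3 : ℝ) * (d : ℝ) ^ (1 / 3 : ℝ) * Real.log T ^ (1 / 3 : ℝ) := by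
  have hT' : (1 : ℝ) < T := by exact_mod_cast hT
  rw [mul_assoc, ← Real.mul_rpow (by positivity) (Real.log_pos hT').le]
  calc (T : ℝ) = (T : ℝ) ^ (2 / 3 : ℝ) * (T : ℝ) ^ (1 / 3 : ℝ) := by
        rw [← Real.rpow_add (by linarith)]
        norm_num
    _ ≤ _ := by gcongr

/-! ### Rates, expectation bound and tail bound. -/

section Main

variable {d T : ℕ} [NeZero d]

theorem integral_residual_law_le (x : Fin T → Context d) (y : Fin T → Label) :
    ∫ p, residual (fun t => (x t : EuclideanSpace ℝ (Fin d))) y p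
      ∂((gradientForecaster d T).law x y) ≤ 5 * (gridSize T : ℝ) ^ 2 := by
  have hN := gridSize_pos T
  have hN1 : (1 : ℝ) ≤ gridSize T := by exact_mod_cast hN
  have h1 := integral_residual_le (N := (gradientForecaster d T).N) hN (fun t => (x t).2.1) y
    (fun t => ((gradientForecaster d T).dist x y t).toMeasure)
  have h2 := sum_norm_sum_prob_le hN (X := contextSeq x) (Y := labelSeq y) (T := T)
    (fun s _ => norm_contextSeq_le x s) (fun s _ => (labelSeq_mem_Icc y s).1)
    (fun s _ => (labelSeq_mem_Icc y s).2)
  have e : ∀ (t : Fin T) (i : Fin (gridSize T + 1)),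
      ((gradientForecaster d T).dist x y t).toMeasure.real {i} =
        prob (gridSize T) (contextSeq x) (labelSeq y) t i := fun t i => by
    rw [← toReal_dist, measureReal_def]
    congr 1
    exact PMF.toMeasure_apply_singleton _ _ (measurableSet_singleton _)
  have e' : ∑ i : Fin (gridSize T + 1),
      ‖∑ t, (((gradientForecaster d T).dist x y t).toMeasure.real {i} * ((y t : ℝ) - grid i)) •
        (x t : EuclideanSpace ℝ (Fin d))‖ =
      ∑ i ∈ Finset.range (gridSize T + 1), ‖∑ s ∈ Finset.range T,
        (prob (gridSize T) (contextSeq x) (labelSeq y) s i * (labelSeq y s - i / gridSize T)) •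
          contextSeq x s‖ := by
    rw [Finset.sum_range]
    refine Finset.sum_congr rfl fun i _ => ?_
    rw [Finset.sum_range]
    congr 1
    refine Finset.sum_congr rfl fun t _ => ?_
    rw [e]
    simp [contextSeq, labelSeq, grid_eq]
  have h3 : (T : ℝ) / gridSize T ≤ (gridSize T : ℝ) ^ 2 := by
    rw [div_le_iff₀ (by positivity), ← pow_succ]
    exact_mod_cast le_gridSize_pow T
  calc _ ≤ _ := h1
    _ ≤ (gridSize T + 1) * gridSize T / 2 + 5 / 2 * (T / gridSize T) +
        ((gridSize T + 1) * gridSize T + T / gridSize T) / 2 :=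
        add_le_add (e'.le.trans h2) le_rfl
    -- With N + 1 ≤ 2N and T/N ≤ N² the three groups are at most N², 5N²/2 and 3N²/2.
    _ ≤ _ := by nlinarith

theorem gridSize_sq_le (hT : 1 ≤ T) : (gridSize T : ℝ) ^ 2 ≤ 4 * (T : ℝ) ^ (2 / 3 : ℝ) := by
  have hT' : (1 : ℝ) ≤ T := by exact_mod_cast hT
  set s := (T : ℝ) ^ (1 / 3 : ℝ) with hs
  have hs1 : 1 ≤ s := Real.one_le_rpow hT' (by norm_num)
  have hs3 : s ^ 3 = T := by
    rw [hs, ← Real.rpow_natCast, ← Real.rpow_mul (by positivity)]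
    norm_num
  have hs2 : (T : ℝ) ^ (2 / 3 : ℝ) = s ^ 2 := by
    rw [hs, ← Real.rpow_natCast, ← Real.rpow_mul (by positivity)]
    norm_num
  have h1 : ((gridSize T - 1 : ℕ) : ℝ) ^ 3 ≤ s ^ 3 := by
    rw [hs3]
    exact_mod_cast gridSize_sub_one_pow_le T
  have h2 := le_of_pow_le_pow_left₀ (by norm_num) (by positivity) h1
  rw [Nat.cast_sub (gridSize_pos T), Nat.cast_one] at h2
  have h3 : (0 : ℝ) ≤ gridSize T := by positivity
  rw [hs2]
  nlinarith

theorem half_le_log_rpow (hT : 2 ≤ T) : 1 / 2 ≤ Real.log T ^ (1 / 3 : ℝ) := by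
  have h2 : (2 : ℝ) ≤ T := by exact_mod_cast hT
  have h1 : (1 / 2 : ℝ) ^ 3 ≤ Real.log T := by
    have := Real.log_le_log two_pos h2
    have := Real.log_two_gt_d9
    norm_num
    linarith
  calc (1 / 2 : ℝ) = ((1 / 2 : ℝ) ^ 3) ^ (1 / 3 : ℝ) := by
        rw [← Real.rpow_natCast, ← Real.rpow_mul (by norm_num)]
        norm_num
    _ ≤ _ := Real.rpow_le_rpow (by norm_num) h1 (by norm_num)

theorem rpow_le_rate (hT : 2 ≤ T) : (T : ℝ) ^ (2 / 3 : ℝ) ≤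
    2 * ((T : ℝ) ^ (2 / 3 : ℝ) * (d : ℝ) ^ (1 / 3 : ℝ) * Real.log T ^ (1 / 3 : ℝ)) := by
  have hd : (1 : ℝ) ≤ (d : ℝ) ^ (1 / 3 : ℝ) :=
    Real.one_le_rpow (by exact_mod_cast Nat.one_le_iff_ne_zero.2 (NeZero.ne d)) (by norm_num)
  have hl := half_le_log_rpow hT
  have h0 : 0 ≤ (T : ℝ) ^ (2 / 3 : ℝ) := by positivity
  have h1 : 1 / 2 ≤ (d : ℝ) ^ (1 / 3 : ℝ) * Real.log T ^ (1 / 3 : ℝ) := by nlinarith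
  nlinarith

/-- The constant is 80 = 2 · 5 · 4 · 2: the norm bound on θ, the residual bound 5N², N² ≤ 4T^{2/3},
and the absorption of T^{2/3} into the rate. -/
theorem two_mul_integral_residual_law_le (hT : 2 ≤ T) (x : Fin T → Context d)
    (y : Fin T → Label) :
    2 * ∫ p, residual (fun t => (x t : EuclideanSpace ℝ (Fin d))) y p
      ∂((gradientForecaster d T).law x y) ≤
      80 * ((T : ℝ) ^ (2 / 3 : ℝ) * (d : ℝ) ^ (1 / 3 : ℝ) * Real.log T ^ (1 / 3 : ℝ)) := by
  have h1 := integral_residual_law_le x y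
  have h2 := gridSize_sq_le (T := T) (by omega)
  have h3 := rpow_le_rate (d := d) hT
  linarith

instance (A : Forecaster d) (x : Fin T → Context d) (y : Fin T → Label) :
    IsProbabilityMeasure (A.law x y) := by
  unfold Forecaster.law
  infer_instance

theorem integral_swapMulticalError_le (hT : 2 ≤ T) (x : Fin T → Context d) (y : Fin T → Label) :
    ∫ p, swapMulticalError (bounded (linClass d) 1) 1 x y p
      ∂((gradientForecaster d T).law x y) ≤
      80 * ((T : ℝ) ^ (2 / 3 : ℝ) * (d : ℝ) ^ (1 / 3 : ℝ) * Real.log T ^ (1 / 3 : ℝ)) := by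
  refine le_trans ?_ (two_mul_integral_residual_law_le hT x y)
  rw [← integral_const_mul]
  exact integral_mono Integrable.of_finite Integrable.of_finite
    fun p => swapMulticalError_le x y p

/-- Here √T = T^{2/3} T^{-1/6}, and T^{-1/6} ≤ (d log T)^{-1/6} in this regime. -/
theorem sqrt_le_deviation (hT : 2 ≤ T) (h : (d : ℝ) * Real.log T ≤ T) (L : ℝ) :
    2 * Real.sqrt (8 * T * L) ≤
      80 * ((T : ℝ) ^ (2 / 3 : ℝ) * ((d : ℝ) * Real.log T) ^ (-(1 / 6) : ℝ) * Real.sqrt L) := by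
  have hT' : (1 : ℝ) < T := by exact_mod_cast hT
  have hd : (0 : ℝ) < d := by exact_mod_cast Nat.pos_of_neZero d
  have hpos : 0 < (d : ℝ) * Real.log T := mul_pos hd (Real.log_pos hT')
  have h1 : Real.sqrt T ≤ (T : ℝ) ^ (2 / 3 : ℝ) * ((d : ℝ) * Real.log T) ^ (-(1 / 6) : ℝ) := by
    have h2 : (T : ℝ) ^ (-(1 / 6) : ℝ) ≤ ((d : ℝ) * Real.log T) ^ (-(1 / 6) : ℝ) :=
      Real.rpow_le_rpow_of_nonpos hpos h (by norm_num)
    calc Real.sqrt T = (T : ℝ) ^ (2 / 3 : ℝ) * (T : ℝ) ^ (-(1 / 6) : ℝ) := by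
          rw [← Real.rpow_add (by linarith), Real.sqrt_eq_rpow]
          norm_num
      _ ≤ _ := by gcongr
  have h8 : Real.sqrt 8 ≤ 3 := by
    rw [Real.sqrt_le_left (by norm_num)]
    norm_num
  rw [Real.sqrt_mul (by positivity), Real.sqrt_mul (by norm_num)]
  have h3 := mul_le_mul h8 h1 (Real.sqrt_nonneg _) (by norm_num)
  have h4 := mul_le_mul_of_nonneg_right h3 (Real.sqrt_nonneg L)
  have h5 : 0 ≤ (T : ℝ) ^ (2 / 3 : ℝ) * ((d : ℝ) * Real.log T) ^ (-(1 / 6) : ℝ) *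
      Real.sqrt L := by positivity
  linarith

theorem le_measure_swapMulticalError_le (hT : 2 ≤ T) (x : Fin T → Context d)
    (y : Fin T → Label) {δ : ℝ} (hδ0 : 0 < δ) (hδ1 : δ < 1) :
    1 - δ ≤ ((gradientForecaster d T).law x y).real
      {p | swapMulticalError (bounded (linClass d) 1) 1 x y p ≤
        80 * ((T : ℝ) ^ (2 / 3 : ℝ) * (d : ℝ) ^ (1 / 3 : ℝ) * Real.log T ^ (1 / 3 : ℝ) +
          (T : ℝ) ^ (2 / 3 : ℝ) * ((d : ℝ) * Real.log T) ^ (-(1 / 6) : ℝ) *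
            Real.sqrt (Real.log (1 / δ)))} := by
  have hT' : (1 : ℝ) < T := by exact_mod_cast hT
  have hlog : 0 < Real.log T := Real.log_pos hT'
  have hL : 0 ≤ Real.log (1 / δ) := Real.log_nonneg (by rw [le_div_iff₀ hδ0]; linarith)
  set G := residual (N := (gradientForecaster d T).N)
    (fun t => (x t : EuclideanSpace ℝ (Fin d))) y with hG
  set S := {p | swapMulticalError (bounded (linClass d) 1) 1 x y p ≤
        80 * ((T : ℝ) ^ (2 / 3 : ℝ) * (d : ℝ) ^ (1 / 3 : ℝ) * Real.log T ^ (1 / 3 : ℝ) +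
          (T : ℝ) ^ (2 / 3 : ℝ) * ((d : ℝ) * Real.log T) ^ (-(1 / 6) : ℝ) *
            Real.sqrt (Real.log (1 / δ)))} with hS
  have hle : ∀ p, swapMulticalError (bounded (linClass d) 1) 1 x y p ≤ 2 * G p :=
    fun p => swapMulticalError_le x y p
  rcases le_or_gt ((d : ℝ) * Real.log T) T with h | h
  -- With differences at most 2, McDiarmid's bound is exp(−ε²/(8T)); this `ε` makes it equal to δ.
  · set ε := Real.sqrt (8 * T * Real.log (1 / δ)) with hε
    have hmc := measure_ge_le_of_bounded_differences zero_le_two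
      (fun t => ((gradientForecaster d T).dist x y t).toMeasure) G
      (fun p t a => abs_residual_update_sub_le (fun t => (x t).2.1) y p t a)
      (Real.sqrt_nonneg (8 * T * Real.log (1 / δ)))
    have hexp : Real.exp (-Real.sqrt (8 * T * Real.log (1 / δ)) ^ 2 / (2 * (T * 2 ^ 2))) = δ := by
      rw [Real.sq_sqrt (by positivity)]
      have : -(8 * T * Real.log (1 / δ)) / (2 * (T * 2 ^ 2)) = -Real.log (1 / δ) := by
        field_simp
        ring
      rw [this, one_div, Real.log_inv, neg_neg, Real.exp_log hδ0]
    rw [hexp] at hmc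
    have hsub : Sᶜ ⊆ {p | ε ≤ G p - ∫ q, G q ∂((gradientForecaster d T).law x y)} := by
      intro p hp
      by_contra hlt
      refine hp ?_
      have h1 := two_mul_integral_residual_law_le hT x y
      have h2 := sqrt_le_deviation hT h (Real.log (1 / δ))
      have h3 := hle p
      have h4 : G p - ∫ q, G q ∂((gradientForecaster d T).law x y) < ε := not_le.1 hlt
      rw [hS, Set.mem_ofPred_eq, mul_add]
      linarith
    have hcompl := (measureReal_mono (μ := (gradientForecaster d T).law x y) hsub).trans hmc
    rw [probReal_compl_eq_one_sub (Set.toFinite S).measurableSet] at hcompl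
    linarith
  · have huniv : S = Set.univ := by
      refine Set.eq_univ_of_forall fun p => ?_
      have h1 := le_rate_of_lt hT h
      have h2 : G p ≤ T := residual_le (fun t => (x t).2.1) y p
      have h3 := hle p
      have h5 : 0 ≤ (T : ℝ) ^ (2 / 3 : ℝ) * ((d : ℝ) * Real.log T) ^ (-(1 / 6) : ℝ) *
          Real.sqrt (Real.log (1 / δ)) := by positivity
      rw [hS, Set.mem_ofPred_eq]
      linarith
    rw [huniv, probReal_univ]
    linarith

end Main

end SwapMulticalibration

theorem mainTheorem2 :
    ∃ A : (d T : ℕ) → [NeZero d] → SwapMulticalibration.Forecaster d,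
      SwapMulticalibration.Efficient A ∧
      ∃ C : ℝ, 0 < C ∧
        ∀ (d T : ℕ) [NeZero d], 2 ≤ T →
          ∀ (x : Fin T → SwapMulticalibration.Context d)
            (y : Fin T → SwapMulticalibration.Label),
            (∀ δ : ℝ, 0 < δ → δ < 1 →
              1 - δ ≤ ((A d T).law x y).real
                {p | SwapMulticalibration.swapMulticalError
                    (SwapMulticalibration.bounded (SwapMulticalibration.linClass d) 1) 1 x y p ≤
                  C * ((T : ℝ) ^ (2 / 3 : ℝ) * (d : ℝ) ^ (1 / 3 : ℝ)
                        * (Real.log T) ^ (1 / 3 : ℝ)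
                      + (T : ℝ) ^ (2 / 3 : ℝ) * ((d : ℝ) * Real.log T) ^ (-(1 / 6) : ℝ)
                        * Real.sqrt (Real.log (1 / δ)))}) ∧
            ∫ p, SwapMulticalibration.swapMulticalError
                (SwapMulticalibration.bounded (SwapMulticalibration.linClass d) 1) 1 x y p
                ∂((A d T).law x y) ≤
              C * ((T : ℝ) ^ (2 / 3 : ℝ) * (d : ℝ) ^ (1 / 3 : ℝ) * (Real.log T) ^ (1 / 3 : ℝ)) :=
  ⟨fun d T => SwapMulticalibration.gradientForecaster d T,
    SwapMulticalibration.efficient_gradientForecaster, 80, by norm_num, fun _ _ _ hT x y =>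
      ⟨fun _ hδ0 hδ1 => SwapMulticalibration.le_measure_swapMulticalError_le hT x y hδ0 hδ1,
        SwapMulticalibration.integral_swapMulticalError_le hT x y⟩⟩
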